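/- Let $\sigma>0$. For $\theta=(\alpha,\beta,d)$, $d=(d_1,d_2)$, with $|\alpha|<1$, $|\beta|<1$, $|d_1|<\tfrac12$, $|d_2|<\tfrac12$, put $$f(x,y,\theta)=\frac{\sigma^2}{4\pi^2}\,\frac{|1-e^{-ix}|^{-2d_1}\,|1-e^{-iy}|^{-2d_2}}{|(1-\alpha e^{-ix})(1-\beta e^{-iy})|^2},\qquad (x,y)\in I^2=[-\pi,\pi]^2 .$$ Let $\{X_{st}:s,t\in\mathbb Z\}$ be a real stationary Gaussian process (constant mean, and $\operatorname{cov}(X_{s+k,t+\ell},X_{st})=\gamma(k,\ell)$ for all $s,t$) with spectral density $f(\cdot,\cdot,\theta_0)$, that is, $\gamma(k,\ell)=\int_{I^2}e^{i(kx+\ell y)}f(x,y,\theta_0)\,dx\,dy$ for all $k,\ell\in\mathbb Z$, where $\theta_0=(\alpha_0,\beta_0,(d_{10},d_{20}))$ satisfies $|\alpha_0|<1$, $|\beta_0|<1$ and $0<d_{10},d_{20}<\tfrac12$. For $N\ge 1$ let $$\bar X_N=\frac1{N^2}\sum_{k,\ell=1}^N X_{k\ell},\qquad I_N(x,y)=\frac1{N^2}\Big|\sum_{k,\ell=1}^N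 e^{i(kx+\ell y)}(X_{k\ell}-\bar X_N)\Big|^2,\qquad \sigma_N^2(\theta)=\int_{I^2}\frac{I_N(x,y)}{f(x,y,\theta)}\,dx\,dy .$$ Let $K$ be a compact subset of $\{(\alpha,\beta,(d_1,d_2)):|\alpha|<1,\ |\beta|<1,\ |d_1|<\tfrac12,\ |d_2|<\tfrac12\}$ with $\theta_0\in K$ (for example $K=\{|\alpha|,|\beta|\le r,\ |d_1|,|d_2|\le s\}$ with $0<r<1$, $0<s<\tfrac12$, if it contains $\theta_0$). Then for every $N\ge1$ the function $\sigma_N^2$ attains its minimum over $K$ at every sample point, and for every choice of $\hat\theta_N\in K$ which, for each $N\ge 1$, almost surely minimizes $\sigma_N^2$ over $K$, one has $\hat\theta_N\to\theta_0$ almost surely as $N\to\infty$. -/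

import Mathlib

open MeasureTheory ProbabilityTheory Filter Topology

noncomputable section

namespace SpatialWhittle

/-- A parameter `θ = (α, β, d)` with memory parameter `d = (d₁, d₂)`. -/
abbrev Param : Type := ℝ × ℝ × (ℝ × ℝ)

/-- The admissible parameters: `|α| < 1`, `|β| < 1`, `|d₁| < 1/2`, `|d₂| < 1/2`. -/
def paramSpace : Set Param :=
  {θ | |θ.1| < 1 ∧ |θ.2.1| < 1 ∧ |θ.2.2.1| < 1 / 2 ∧ |θ.2.2.2| < 1 / 2}

/-- The autoregressive polynomial `φ(z₁, z₂, α, β) = (1 - α z₁) (1 - β z₂)`. -/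
def arPoly (z₁ z₂ : ℂ) (α β : ℝ) : ℂ := (1 - (α : ℂ) * z₁) * (1 - (β : ℂ) * z₂)

/-- The spectral density of the fractional autoregressive spatial model at the frequency
`p = (x, y)`:
`f(x, y, θ) = σ² / (4π²) * |1 - e^{-ix}|^{-2d₁} |1 - e^{-iy}|^{-2d₂} / |φ(e^{-ix}, e^{-iy}, α, β)|²`. -/
def specDensity (σ : ℝ) (θ : Param) (p : ℝ × ℝ) : ℝ :=
  σ ^ 2 / (4 * Real.pi ^ 2) *
    (‖1 - Complex.exp (-(Complex.I * (p.1 : ℂ)))‖ ^ (-2 * θ.2.2.1) *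
        ‖1 - Complex.exp (-(Complex.I * (p.2 : ℂ)))‖ ^ (-2 * θ.2.2.2) /
      ‖arPoly (Complex.exp (-(Complex.I * (p.1 : ℂ)))) (Complex.exp (-(Complex.I * (p.2 : ℂ))))
          θ.1 θ.2.1‖ ^ 2)

/-- The frequency square `I² = [-π, π] × [-π, π]`. -/
def freqSquare : Set (ℝ × ℝ) :=
  Set.Icc (-Real.pi) Real.pi ×ˢ Set.Icc (-Real.pi) Real.pi

/-- Second-order stationarity of a random field indexed by `ℤ × ℤ`: finite second moments,
constant mean, and `cov(X_{s+k,t+l}, X_{s,t})` independent of `(s, t)`. -/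
structure IsStationary {Ω : Type*} [MeasurableSpace Ω] (X : ℤ × ℤ → Ω → ℝ) (P : Measure Ω) :
    Prop where
  memLp_two : ∀ u, MemLp (X u) 2 P
  mean_eq : ∀ u v, ∫ ω, X u ω ∂P = ∫ ω, X v ω ∂P
  cov_eq : ∀ h u v : ℤ × ℤ,
    covariance (X (u + h)) (X u) P = covariance (X (v + h)) (X v) P

/-- `f` is a spectral density of the (stationary) field `X`: it is nonnegative and integrable on
the frequency square, and the autocovariances are
`γ(k, l) = ∫_{I²} e^{i(kx+ly)} f(x, y) dx dy`. -/
structure HasSpectralDensity {Ω : Type*} [MeasurableSpace Ω] (X : ℤ × ℤ → Ω → ℝ) (P : Measure Ω)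
    (f : ℝ × ℝ → ℝ) : Prop where
  nonneg : ∀ p ∈ freqSquare, 0 ≤ f p
  integrableOn : IntegrableOn f freqSquare
  cov_eq_integral : ∀ h u : ℤ × ℤ,
    ((covariance (X (u + h)) (X u) P : ℝ) : ℂ) =
      ∫ p in freqSquare,
        Complex.exp (Complex.I * ((h.1 : ℂ) * (p.1 : ℂ) + (h.2 : ℂ) * (p.2 : ℂ))) * (f p : ℂ)

/-- The sample mean `(1 / N²) ∑_{k,l=1}^N x_{kl}` of the data `x`. -/
def sampleMean (N : ℕ) (x : ℤ × ℤ → ℝ) : ℝ :=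
  1 / (N : ℝ) ^ 2 * ∑ k ∈ Finset.Icc 1 N, ∑ l ∈ Finset.Icc 1 N, x ((k : ℤ), (l : ℤ))

/-- The periodogram `I_N(x, y)` of the data `x` at the frequency `p = (x, y)`. -/
def periodogram (N : ℕ) (x : ℤ × ℤ → ℝ) (p : ℝ × ℝ) : ℝ :=
  1 / (N : ℝ) ^ 2 *
    ‖∑ k ∈ Finset.Icc 1 N, ∑ l ∈ Finset.Icc 1 N,
        Complex.exp (Complex.I * ((k : ℂ) * (p.1 : ℂ) + (l : ℂ) * (p.2 : ℂ))) *
          ((x ((k : ℤ), (l : ℤ)) - sampleMean N x : ℝ) : ℂ)‖ ^ 2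

/-- The Whittle objective `σ_N²(θ) = ∫_{I²} I_N(x, y) / f(x, y, θ) dx dy`. -/
def whittleObjective (σ : ℝ) (N : ℕ) (x : ℤ × ℤ → ℝ) (θ : Param) : ℝ :=
  ∫ p in freqSquare, periodogram N x p / specDensity σ θ p

/-- `θ` is a Whittle estimate over the parameter set `K` from the data `x_{kl}`, `1 ≤ k, l ≤ N`:
it lies in `K` and minimizes `σ_N²` over `K`. -/
def IsWhittleEstimate (σ : ℝ) (K : Set Param) (N : ℕ) (x : ℤ × ℤ → ℝ) (θ : Param) : Prop :=
  θ ∈ K ∧ ∀ θ' ∈ K, whittleObjective σ N x θ ≤ whittleObjective σ N x θ'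

end SpatialWhittle

end

/-! The argument has an ergodic part, a weak convergence part and an identification part.

Ergodic part. For Gaussian fields the covariance of two squares is twice the squared covariance. So
laws of large numbers for sample autocovariances only need ∑ γ(u-v+h)² over u, v in the window to be
O(N^(4-2ε)). This holds because the true density lies in L^(1+ε)
(`exists_sum_norm_sq_fourierCoef_le`: truncate at height N and use Bessel below the cut). Summable
second moments along N = j^q, monotone interpolation and polarization then give almost sure
convergence at every lag (`ae_tendsto_lag_averages`).

Weak convergence part. The Fourier coefficients of I_N are, up to 4π², sample autocovariances. Hence
almost surely the measures I_N dx dy converge weakly on the torus to 4π² f(·, θ₀) dx dy, even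
against test functions varying with N but converging uniformly (`tendsto_integral_periodogram_mul`).
The function 1/f(·, θ) need not be continuous: it blows up on an axis when a memory parameter is
negative. It is therefore replaced, at the estimates, by jointly continuous lower bounds `lowerInv`;
at θ₀ no replacement is needed, since d₁₀, d₂₀ > 0 makes 1/f(·, θ₀) continuous. Minimality
σ_N²(θ̂_N) ≤ σ_N²(θ₀), followed by Fatou, gives ∫ f(·, θ₀)/f(·, θ) ≤ 4π² at every cluster point θ.

Identification part. By Jensen's formula ∫ log f(·, θ) does not depend on θ. With t = f(·, θ₀)/f(·,
θ), the nonnegative function t - 1 - log t thus has integral at most 0, so t = 1 almost everywhere,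
and the two densities determine the same parameter. Compactness of K turns uniqueness of the cluster
point into convergence. -/

noncomputable section

namespace SpatialWhittle

/-! ### Fourth moments of Gaussian variables -/

section GaussianMoments

variable {Ω : Type*} [MeasurableSpace Ω] {P : Measure Ω}

lemma iteratedDeriv_four_exp_sq (v : ℝ) :
    iteratedDeriv 4 (fun t : ℝ => Real.exp (v * t ^ 2 / 2)) 0 = 3 * v ^ 2 := by
  have hE : ∀ t : ℝ, HasDerivAt (fun t : ℝ => Real.exp (v * t ^ 2 / 2))
      (v * t * Real.exp (v * t ^ 2 / 2)) t := fun t => by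
    have h := (((hasDerivAt_pow 2 t).const_mul v).div_const 2).exp
    refine h.congr_deriv ?_
    push_cast
    ring
  have key : ∀ (p p' : ℝ → ℝ), (∀ t, HasDerivAt p (p' t) t) →
      deriv (fun t => p t * Real.exp (v * t ^ 2 / 2)) =
        fun t => (p' t + p t * (v * t)) * Real.exp (v * t ^ 2 / 2) := fun p p' hp => by
    ext t
    have h := ((hp t).mul (hE t)).deriv
    simp only [Pi.mul_def] at h
    rw [h]
    ring
  have h1 : deriv (fun t : ℝ => Real.exp (v * t ^ 2 / 2)) =
      fun t => (v * t) * Real.exp (v * t ^ 2 / 2) := by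
    ext t
    exact (hE t).deriv
  have hd1 : ∀ t : ℝ, HasDerivAt (fun t : ℝ => v * t) v t := fun t => by
    simpa using (hasDerivAt_id t).const_mul v
  have hd2 : ∀ t : ℝ, HasDerivAt (fun t : ℝ => v + v * t * (v * t)) (2 * v ^ 2 * t) t := fun t => by
    refine (((hd1 t).mul (hd1 t)).const_add v).congr_deriv ?_
    ring
  have hd3 : ∀ t : ℝ, HasDerivAt (fun t : ℝ => 2 * v ^ 2 * t + (v + v * t * (v * t)) * (v * t))
      (2 * v ^ 2 + (2 * v ^ 2 * t * (v * t) + (v + v * t * (v * t)) * v)) t := fun t => by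
    refine HasDerivAt.add ?_ ((hd2 t).mul (hd1 t))
    simpa using (hasDerivAt_id t).const_mul (2 * v ^ 2)
  rw [iteratedDeriv_succ', iteratedDeriv_succ', iteratedDeriv_succ', iteratedDeriv_succ',
    iteratedDeriv_zero, h1, key _ _ hd1, key _ _ hd2, key _ _ hd3]
  simp
  ring

/-- The fourth moment is the fourth derivative at 0 of the moment generating function exp(v t²/2).
The degenerate case v = 0 needs no separate treatment. -/
lemma integral_pow_four_of_hasGaussianLaw [IsProbabilityMeasure P] {Y : Ω → ℝ}
    (h : HasGaussianLaw Y P) (h0 : ∫ ω, Y ω ∂P = 0) :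
    ∫ ω, Y ω ^ 4 ∂P = 3 * (∫ ω, Y ω ^ 2 ∂P) ^ 2 := by
  have hlaw := h.map_eq_gaussianReal
  have hvar : Var[Y; P] = ∫ ω, Y ω ^ 2 ∂P := variance_of_integral_eq_zero h.aemeasurable h0
  have hnn : 0 ≤ ∫ ω, Y ω ^ 2 ∂P := integral_nonneg fun ω => sq_nonneg _
  rw [h0, hvar] at hlaw
  have hmgf : mgf Y P = fun t => Real.exp ((∫ ω, Y ω ^ 2 ∂P) * t ^ 2 / 2) := by
    ext t
    rw [mgf_gaussianReal hlaw, Real.coe_toNNReal _ hnn, zero_mul, zero_add]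
  have hint : integrableExpSet Y P = Set.univ := by
    have := integrableExpSet_id_gaussianReal (μ := 0) (v := (∫ ω, Y ω ^ 2 ∂P).toNNReal)
    rw [← hlaw] at this
    ext t
    have ht : t ∈ integrableExpSet id (Measure.map Y P) := by rw [this]; trivial
    simp only [Set.mem_univ, iff_true]
    simp only [integrableExpSet, Set.mem_ofPred_eq] at ht ⊢
    exact (integrable_map_measure (by fun_prop) h.aemeasurable).1 ht
  have := iteratedDeriv_mgf_zero (X := Y) (μ := P) (by simp [hint]) 4
  rw [hmgf, iteratedDeriv_four_exp_sq] at this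
  simpa using this.symm

/-- Isserlis' formula by polarization: 12 U²V² = (U+V)⁴ + (U-V)⁴ - 2U⁴ - 2V⁴, and every fourth power
on the right is that of a centred Gaussian. -/
lemma integral_sq_mul_sq_of_hasGaussianLaw [IsProbabilityMeasure P] {U V : Ω → ℝ}
    (h : HasGaussianLaw (fun ω => (U ω, V ω)) P) (hU : ∫ ω, U ω ∂P = 0) (hV : ∫ ω, V ω ∂P = 0) :
    ∫ ω, U ω ^ 2 * V ω ^ 2 ∂P =
      (∫ ω, U ω ^ 2 ∂P) * (∫ ω, V ω ^ 2 ∂P) + 2 * (∫ ω, U ω * V ω ∂P) ^ 2 := by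
  have i4 : ∀ {Y : Ω → ℝ}, HasGaussianLaw Y P → Integrable (fun ω => Y ω ^ 4) P := fun hY => by
    have := (hY.memLp (p := 4) (by simp)).integrable_norm_pow (p := 4) (by norm_num)
    refine this.congr (ae_of_all _ fun ω => ?_)
    simp only [Real.norm_eq_abs]
    exact Even.pow_abs (by decide) _
  have hU' := h.fst
  have hV' := h.snd
  have hp := h.fun_add
  have hm := h.fun_sub
  have iU := hU'.integrable
  have iV := hV'.integrable
  have iUU := hU'.memLp_two.integrable_sq
  have iVV := hV'.memLp_two.integrable_sq
  have iUV : Integrable (fun ω => U ω * V ω) P := hU'.memLp_two.integrable_mul hV'.memLp_two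
  have ep := integral_pow_four_of_hasGaussianLaw hp (by rw [integral_add iU iV, hU, hV, add_zero])
  have em := integral_pow_four_of_hasGaussianLaw hm (by rw [integral_sub iU iV, hU, hV, sub_zero])
  have eU := integral_pow_four_of_hasGaussianLaw hU' hU
  have eV := integral_pow_four_of_hasGaussianLaw hV' hV
  have e2p : ∫ ω, (U ω + V ω) ^ 2 ∂P =
      ∫ ω, U ω ^ 2 ∂P + 2 * ∫ ω, U ω * V ω ∂P + ∫ ω, V ω ^ 2 ∂P := by
    rw [← integral_const_mul, ← integral_add iUU (iUV.const_mul 2),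
      ← integral_add (iUU.fun_add (iUV.const_mul 2)) iVV]
    exact integral_congr_ae (ae_of_all _ fun ω => by simp only []; ring)
  have e2m : ∫ ω, (U ω - V ω) ^ 2 ∂P =
      ∫ ω, U ω ^ 2 ∂P - 2 * ∫ ω, U ω * V ω ∂P + ∫ ω, V ω ^ 2 ∂P := by
    rw [← integral_const_mul, ← integral_sub iUU (iUV.const_mul 2),
      ← integral_add (show Integrable (fun ω => U ω ^ 2 - 2 * (U ω * V ω)) P from
        iUU.sub (iUV.const_mul 2)) iVV]
    exact integral_congr_ae (ae_of_all _ fun ω => by simp only []; ring)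
  have key : ∫ ω, U ω ^ 2 * V ω ^ 2 ∂P = 1 / 12 * (∫ ω, (U ω + V ω) ^ 4 ∂P +
      ∫ ω, (U ω - V ω) ^ 4 ∂P - 2 * ∫ ω, U ω ^ 4 ∂P - 2 * ∫ ω, V ω ^ 4 ∂P) := by
    rw [← integral_const_mul 2, ← integral_const_mul 2, ← integral_add (i4 hp) (i4 hm),
      ← integral_sub ((i4 hp).fun_add (i4 hm)) ((i4 hU').const_mul 2),
      ← integral_sub (show Integrable (fun ω => (U ω + V ω) ^ 4 + (U ω - V ω) ^ 4 - 2 * U ω ^ 4) P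
        from ((i4 hp).add (i4 hm)).sub ((i4 hU').const_mul 2)) ((i4 hV').const_mul 2),
      ← integral_const_mul]
    exact integral_congr_ae (ae_of_all _ fun ω => by simp only []; ring)
  rw [key, ep, em, eU, eV, e2p, e2m]
  ring

lemma IsGaussianProcess.sub_const {T : Type*} {X : T → Ω → ℝ} (hX : IsGaussianProcess X P)
    (m : T → ℝ) : IsGaussianProcess (fun t ω => X t ω - m t) P where
  hasGaussianLaw I := by
    have h := hX.hasGaussianLaw I
    have hg := h.isGaussian_map
    constructor
    have e : (fun ω => I.restrict fun t => X t ω - m t) =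
        (fun x => x - I.restrict m) ∘ fun ω => I.restrict (X · ω) := rfl
    rw [e, ← AEMeasurable.map_map_of_aemeasurable (by fun_prop) h.aemeasurable]
    infer_instance

lemma IsGaussianProcess.linear_comb {X : ℤ × ℤ → Ω → ℝ} (hX : IsGaussianProcess X P)
    (a b : ℝ) (h : ℤ × ℤ) : IsGaussianProcess (fun u ω => a * X u ω + b * X (u + h) ω) P := by
  classical
  refine hX.of_isGaussianProcess fun u => ⟨{u, u + h},
    { toFun x := a * x ⟨u, by simp⟩ + b * x ⟨u + h, by simp⟩
      map_add' x y := by simp; ring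
      map_smul' c x := by simp; ring }, ?_⟩
  intro ω
  simp

end GaussianMoments

/-! ### From second moments to almost sure convergence -/

section StrongLaw

variable {Ω : Type*} [MeasurableSpace Ω] {P : Measure Ω}

/-- Along N = j^q the second moments are summable, so by Tonelli the series of squares is almost
surely finite and its terms tend to 0. -/
lemma ae_tendsto_zero_of_integral_sq_le {A : ℕ → Ω → ℝ} {C a : ℝ}
    (hA : ∀ N, Integrable (fun ω => A N ω ^ 2) P)
    (hb : ∀ N : ℕ, 1 ≤ N → ∫ ω, A N ω ^ 2 ∂P ≤ C * (N : ℝ) ^ (-a)) {q : ℕ} (hq : 1 < q * a) :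
    ∀ᵐ ω ∂P, Tendsto (fun j : ℕ => A (j ^ q) ω) atTop (𝓝 0) := by
  -- The shift to j + 1 avoids N = 0, where no moment bound is assumed.
  have hs : Summable fun j : ℕ => C * ((j + 1 : ℕ) : ℝ) ^ (-(q * a)) :=
    ((summable_nat_add_iff 1).2 (Real.summable_nat_rpow.2 (by linarith))).mul_left C
  have hle : ∀ j : ℕ, ∫⁻ ω, ENNReal.ofReal (A ((j + 1) ^ q) ω ^ 2) ∂P ≤
      ENNReal.ofReal (C * ((j + 1 : ℕ) : ℝ) ^ (-(q * a))) := fun j => by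
    rw [← ofReal_integral_eq_lintegral_ofReal (hA _) (ae_of_all _ fun ω => sq_nonneg _)]
    refine ENNReal.ofReal_le_ofReal ((hb _ (Nat.one_le_pow _ _ j.succ_pos)).trans_eq ?_)
    rw [Nat.cast_pow, ← Real.rpow_natCast, ← Real.rpow_mul (by positivity), mul_neg]
  have hfin : ∫⁻ ω, ∑' j : ℕ, ENNReal.ofReal (A ((j + 1) ^ q) ω ^ 2) ∂P ≠ ⊤ := by
    rw [lintegral_tsum fun j => (hA _).aestronglyMeasurable.aemeasurable.ennreal_ofReal]
    exact ne_top_of_le_ne_top hs.tsum_ofReal_ne_top (ENNReal.tsum_le_tsum hle)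
  filter_upwards [ae_lt_top' (AEMeasurable.tsum fun j =>
    (hA _).aestronglyMeasurable.aemeasurable.ennreal_ofReal) hfin] with ω hω
  have h0 := ENNReal.tendsto_atTop_zero_of_tsum_ne_top hω.ne
  have h1 : Tendsto (fun j : ℕ => A ((j + 1) ^ q) ω ^ 2) atTop (𝓝 0) := by
    have := (ENNReal.tendsto_toReal (by simp : (0 : ENNReal) ≠ ⊤)).comp h0
    simpa [Function.comp_def, ENNReal.toReal_ofReal (sq_nonneg _)] using this
  rw [← tendsto_add_atTop_iff_nat 1]
  refine (tendsto_zero_iff_abs_tendsto_zero _).2 ?_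
  have h2 := (Real.continuous_sqrt.tendsto 0).comp h1
  simpa [Function.comp_def, Real.sqrt_sq_eq_abs] using h2

/-- Monotonicity fills the gaps because consecutive terms of j^(2q) have ratio tending to 1. Passing
to n ↦ S(⌊√n⌋) turns the normalization N² into the linear one of the standard interpolation lemma.
-/
lemma tendsto_div_sq_of_monotone_of_pow_subseq {S : ℕ → ℝ} (hS : Monotone S) {q : ℕ} (hq : 0 < q)
    {m : ℝ} (h : Tendsto (fun j : ℕ => S (j ^ q) / ((j ^ q : ℕ) : ℝ) ^ 2) atTop (𝓝 m)) :
    Tendsto (fun N : ℕ => S N / (N : ℝ) ^ 2) atTop (𝓝 m) := by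
  have hu : Tendsto (fun n : ℕ => S (Nat.sqrt n) / (n : ℝ)) atTop (𝓝 m) := by
    refine tendsto_div_of_monotone_of_exists_subseq_tendsto_div (fun n => S (Nat.sqrt n)) m
      (fun a b hab => hS (Nat.sqrt_le_sqrt hab)) fun a ha =>
      ⟨fun j => (j ^ q) ^ 2, ?_, ?_, ?_⟩
    · have hlim : Tendsto (fun n : ℕ => (1 + 1 / (n : ℝ)) ^ (q * 2)) atTop (𝓝 1) := by
        have := (tendsto_const_nhds (x := (1 : ℝ))).add (tendsto_one_div_atTop_nhds_zero_nat (𝕜 := ℝ))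
        simpa using this.pow (q * 2)
      filter_upwards [hlim.eventually (gt_mem_nhds ha), eventually_gt_atTop 0] with n hn hn0
      have hn0' : (0 : ℝ) < n := by exact_mod_cast hn0
      have e : ((((n + 1) ^ q) ^ 2 : ℕ) : ℝ) = (1 + 1 / (n : ℝ)) ^ (q * 2) * (((n ^ q) ^ 2 : ℕ) : ℝ) := by
        push_cast
        rw [← pow_mul, ← pow_mul, ← mul_pow]
        congr 1
        field_simp
      rw [e]
      exact mul_le_mul_of_nonneg_right hn.le (by positivity)
    · have : ∀ j : ℕ, (j ^ q) ^ 2 = j ^ (q * 2) := fun j => by rw [pow_mul]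
      simp only [this]
      exact tendsto_pow_atTop (by omega)
    · refine h.congr fun j => ?_
      simp only [Nat.sqrt_eq']
      push_cast
      rfl
  have := hu.comp (tendsto_pow_atTop (α := ℕ) (n := 2) (by omega))
  refine this.congr fun N => ?_
  simp [sq]

end StrongLaw

/-! ### Fourier coefficients on the frequency square and sums of squared covariances -/

section Fourier

/-- The exponential `e^{i(kx+ly)}` with frequency index `(k, l)`. -/
def expChar (h : ℤ × ℤ) (p : ℝ × ℝ) : ℂ :=
  Complex.exp (Complex.I * ((h.1 : ℂ) * (p.1 : ℂ) + (h.2 : ℂ) * (p.2 : ℂ)))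

/-- The observation window `[1, N]²`. -/
def box (N : ℕ) : Finset (ℤ × ℤ) := Finset.Icc 1 (N : ℤ) ×ˢ Finset.Icc 1 (N : ℤ)

lemma card_box (N : ℕ) : (box N).card = N ^ 2 := by
  simp [box, sq]

lemma box_mono : Monotone box := fun a b hab => by
  have : (a : ℤ) ≤ b := by exact_mod_cast hab
  exact Finset.product_subset_product (Finset.Icc_subset_Icc_right this)
    (Finset.Icc_subset_Icc_right this)

@[fun_prop]
lemma continuous_expChar (h : ℤ × ℤ) : Continuous (expChar h) := by
  unfold expChar
  fun_prop

lemma expChar_eq (h : ℤ × ℤ) (p : ℝ × ℝ) :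
    expChar h p = Complex.exp (((h.1 * p.1 + h.2 * p.2 : ℝ) : ℂ) * Complex.I) := by
  unfold expChar
  congr 1
  push_cast
  ring

@[simp]
lemma norm_expChar (h : ℤ × ℤ) (p : ℝ × ℝ) : ‖expChar h p‖ = 1 := by
  rw [expChar_eq, Complex.norm_exp_ofReal_mul_I]

lemma expChar_mul (h k : ℤ × ℤ) (p : ℝ × ℝ) : expChar h p * expChar k p = expChar (h + k) p := by
  rw [expChar_eq, expChar_eq, expChar_eq, ← Complex.exp_add]
  congr 1
  simp only [Prod.fst_add, Prod.snd_add]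
  push_cast
  ring

lemma conj_expChar (h : ℤ × ℤ) (p : ℝ × ℝ) : (starRingEnd ℂ) (expChar h p) = expChar (-h) p := by
  rw [expChar_eq, expChar_eq, ← Complex.exp_conj]
  congr 1
  simp only [Prod.fst_neg, Prod.snd_neg, map_mul, Complex.conj_ofReal, Complex.conj_I]
  push_cast
  ring

lemma isCompact_freqSquare : IsCompact freqSquare := isCompact_Icc.prod isCompact_Icc

lemma measurableSet_freqSquare : MeasurableSet freqSquare := isCompact_freqSquare.measurableSet

lemma integral_exp_int_mul (k : ℤ) :
    ∫ x in Set.Icc (-Real.pi) Real.pi, Complex.exp (Complex.I * ((k : ℂ) * (x : ℂ))) =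
      if k = 0 then 2 * (Real.pi : ℂ) else 0 := by
  rw [integral_Icc_eq_integral_Ioc,
    ← intervalIntegral.integral_of_le (by linarith [Real.pi_pos])]
  split_ifs with hk
  · subst hk
    simp
    ring
  · have hc : Complex.I * (k : ℂ) ≠ 0 := mul_ne_zero Complex.I_ne_zero (by exact_mod_cast hk)
    simp only [← mul_assoc]
    rw [integral_exp_mul_complex hc]
    have e : Complex.exp (Complex.I * k * (Real.pi : ℝ)) =
        Complex.exp (Complex.I * k * ((-Real.pi : ℝ) : ℂ)) := by
      rw [Complex.exp_eq_exp_iff_exists_int]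
      exact ⟨k, by push_cast; ring⟩
    rw [e, sub_self, zero_div]

lemma integral_expChar (h : ℤ × ℤ) :
    ∫ p in freqSquare, expChar h p = if h = 0 then 4 * (Real.pi : ℂ) ^ 2 else 0 := by
  have e : ∀ p : ℝ × ℝ, expChar h p = Complex.exp (Complex.I * ((h.1 : ℂ) * (p.1 : ℂ))) *
      Complex.exp (Complex.I * ((h.2 : ℂ) * (p.2 : ℂ))) := fun p => by
    rw [expChar, mul_add, Complex.exp_add]
  simp_rw [e]
  rw [freqSquare, Measure.volume_eq_prod,
    setIntegral_prod_mul (fun x : ℝ => Complex.exp (Complex.I * ((h.1 : ℂ) * (x : ℂ))))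
      (fun y : ℝ => Complex.exp (Complex.I * ((h.2 : ℂ) * (y : ℂ)))),
    integral_exp_int_mul, integral_exp_int_mul]
  simp only [Prod.ext_iff, Prod.fst_zero, Prod.snd_zero]
  by_cases h1 : h.1 = 0 <;> by_cases h2 : h.2 = 0 <;> simp [h1, h2]
  ring

lemma _root_.Continuous.integrableOn_freqSquare {E : Type*} [NormedAddCommGroup E] {g : ℝ × ℝ → E}
    (hg : Continuous g) : IntegrableOn g freqSquare :=
  hg.continuousOn.integrableOn_compact isCompact_freqSquare

lemma normSq_sum_expChar (S : Finset (ℤ × ℤ)) (c : ℤ × ℤ → ℂ) (p : ℝ × ℝ) :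
    ((‖∑ u ∈ S, c u * expChar u p‖ ^ 2 : ℝ) : ℂ) =
      ∑ u ∈ S, ∑ v ∈ S, c u * (starRingEnd ℂ) (c v) * expChar (u - v) p := by
  push_cast
  rw [← Complex.mul_conj', map_sum, Finset.sum_mul_sum]
  refine Finset.sum_congr rfl fun u _ => Finset.sum_congr rfl fun v _ => ?_
  rw [map_mul, conj_expChar, sub_eq_add_neg, ← expChar_mul]
  ring

/-- Expanding the square, orthogonality of the characters keeps only the pairs with v = u + h. -/
lemma integral_normSq_sum_mul_expChar (S : Finset (ℤ × ℤ)) (c : ℤ × ℤ → ℂ) (h : ℤ × ℤ) :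
    ∫ p in freqSquare, ((‖∑ u ∈ S, c u * expChar u p‖ ^ 2 : ℝ) : ℂ) * expChar h p =
      4 * (Real.pi : ℂ) ^ 2 *
        ∑ u ∈ S with u + h ∈ S, c u * (starRingEnd ℂ) (c (u + h)) := by
  have e : ∀ p, ((‖∑ u ∈ S, c u * expChar u p‖ ^ 2 : ℝ) : ℂ) * expChar h p =
      ∑ u ∈ S, ∑ v ∈ S, c u * (starRingEnd ℂ) (c v) * expChar (u - v + h) p := fun p => by
    rw [normSq_sum_expChar, Finset.sum_mul]
    refine Finset.sum_congr rfl fun u _ => ?_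
    rw [Finset.sum_mul]
    refine Finset.sum_congr rfl fun v _ => ?_
    rw [← expChar_mul]
    ring
  simp_rw [e]
  rw [integral_finsetSum _ fun u _ => Continuous.integrableOn_freqSquare (by fun_prop),
    Finset.sum_filter, Finset.mul_sum]
  refine Finset.sum_congr rfl fun u _ => ?_
  rw [integral_finsetSum _ fun v _ => Continuous.integrableOn_freqSquare (by fun_prop)]
  simp_rw [integral_const_mul, integral_expChar]
  have e2 : ∀ v, (u - v + h = 0) ↔ (u + h = v) := fun v => by
    rw [sub_add_eq_add_sub, sub_eq_zero]
  simp only [e2, mul_ite, mul_zero]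
  rw [Finset.sum_ite_eq]
  refine if_congr Iff.rfl ?_ rfl
  ring

lemma integral_normSq_sum (S : Finset (ℤ × ℤ)) (c : ℤ × ℤ → ℂ) :
    ∫ p in freqSquare, ‖∑ u ∈ S, c u * expChar u p‖ ^ 2 =
      4 * Real.pi ^ 2 * ∑ u ∈ S, ‖c u‖ ^ 2 := by
  have h := integral_normSq_sum_mul_expChar S c 0
  have e0 : ∀ p, expChar 0 p = 1 := fun p => by simp [expChar]
  simp only [e0, mul_one, add_zero, Finset.filter_mem_eq_inter, Finset.inter_self] at h
  have h' := (integral_complex_ofReal (μ := volume.restrict freqSquare)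
    (f := fun p => ‖∑ u ∈ S, c u * expChar u p‖ ^ 2)).symm.trans h
  have : ((∫ p in freqSquare, ‖∑ u ∈ S, c u * expChar u p‖ ^ 2 : ℝ) : ℂ) =
      ((4 * Real.pi ^ 2 * ∑ u ∈ S, ‖c u‖ ^ 2 : ℝ) : ℂ) := by
    rw [h']
    push_cast
    simp_rw [Complex.mul_conj']
  exact_mod_cast this

/-- The Fourier coefficient `∫_{I²} e^{i(kx+ly)} F(x, y) dx dy`. -/
def fourierCoef (F : ℝ × ℝ → ℝ) (h : ℤ × ℤ) : ℂ := ∫ p in freqSquare, expChar h p * (F p : ℂ)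

lemma integrableOn_expChar_mul {F : ℝ × ℝ → ℝ} (hF : IntegrableOn F freqSquare) (h : ℤ × ℤ) :
    IntegrableOn (fun p => expChar h p * (F p : ℂ)) freqSquare :=
  hF.ofReal.bdd_mul (continuous_expChar h).aestronglyMeasurable
    (ae_of_all _ fun p => (norm_expChar h p).le)

lemma norm_fourierCoef_le {F : ℝ × ℝ → ℝ} (hF0 : ∀ p ∈ freqSquare, 0 ≤ F p) (h : ℤ × ℤ) :
    ‖fourierCoef F h‖ ≤ ∫ p in freqSquare, F p := by
  refine (norm_integral_le_integral_norm _).trans_eq ?_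
  refine setIntegral_congr_fun measurableSet_freqSquare fun p hp => ?_
  simp [abs_of_nonneg (hF0 p hp)]

/-- Bessel's inequality, by testing F against the trigonometric polynomial T built from its own
coefficients. -/
lemma sum_norm_sq_fourierCoef_le {F : ℝ × ℝ → ℝ} (hF : IntegrableOn F freqSquare)
    (hF2 : IntegrableOn (fun p => F p ^ 2) freqSquare) (S : Finset (ℤ × ℤ)) :
    ∑ w ∈ S, ‖fourierCoef F w‖ ^ 2 ≤ 4 * Real.pi ^ 2 * ∫ p in freqSquare, F p ^ 2 := by
  set c : ℤ × ℤ → ℂ := fun w => (starRingEnd ℂ) (fourierCoef F w) with hc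
  set T : ℝ × ℝ → ℂ := fun p => ∑ w ∈ S, c w * expChar w p with hT
  set s : ℝ := ∑ w ∈ S, ‖fourierCoef F w‖ ^ 2 with hs
  have hTc : Continuous T := by fun_prop
  have hT2 : ∫ p in freqSquare, ‖T p‖ ^ 2 = 4 * Real.pi ^ 2 * s := by
    rw [integral_normSq_sum]
    simp [hc, hs]
  have h1 : (s : ℂ) = ∫ p in freqSquare, T p * (F p : ℂ) := by
    simp only [hT, Finset.sum_mul, mul_assoc]
    rw [integral_finsetSum _ fun w _ => (integrableOn_expChar_mul hF w).const_mul _]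
    simp_rw [integral_const_mul]
    rw [hs]
    push_cast
    refine Finset.sum_congr rfl fun w _ => ?_
    rw [← Complex.conj_mul']
    rfl
  have hTi : IntegrableOn (fun p => ‖T p‖ ^ 2) freqSquare :=
    Continuous.integrableOn_freqSquare (by fun_prop)
  -- The weights in the arithmetic-geometric inequality are such that, by `hT2`, the T-term
  -- integrates to s / 2 and can be absorbed on the left.
  have h2 : s ≤ ∫ p in freqSquare, (2 * Real.pi ^ 2 * F p ^ 2 + 1 / (8 * Real.pi ^ 2) * ‖T p‖ ^ 2) := by
    have : s = ‖(s : ℂ)‖ := by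
      rw [Complex.norm_real, Real.norm_of_nonneg]
      exact Finset.sum_nonneg fun w _ => sq_nonneg _
    rw [this, h1]
    refine norm_integral_le_of_norm_le ?_ (ae_of_all _ fun p => ?_)
    · exact (hF2.const_mul _).add (Integrable.const_mul hTi _)
    · rw [norm_mul, Complex.norm_real, Real.norm_eq_abs, ← sq_abs (F p)]
      have : 2 * Real.pi ^ 2 * |F p| ^ 2 + 1 / (8 * Real.pi ^ 2) * ‖T p‖ ^ 2 - ‖T p‖ * |F p| =
          1 / (8 * Real.pi ^ 2) * (4 * Real.pi ^ 2 * |F p| - ‖T p‖) ^ 2 := by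
        field_simp
        ring
      have h0 : 0 ≤ 1 / (8 * Real.pi ^ 2) * (4 * Real.pi ^ 2 * |F p| - ‖T p‖) ^ 2 := by positivity
      linarith
  rw [integral_add (hF2.const_mul _) (Integrable.const_mul hTi _), integral_const_mul,
    integral_const_mul, hT2] at h2
  have e : 1 / (8 * Real.pi ^ 2) * (4 * Real.pi ^ 2 * s) = s / 2 := by
    field_simp
    ring
  rw [e] at h2
  linarith

/-- Split f at height N. The part below satisfies f₁² ≤ N f, so Bessel bounds each inner sum by a
multiple of N, uniformly in h, and the whole by N³. The part above satisfies f₂ ≤ N^(-ε) f^(1+ε), so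
each of the N⁴ terms is O(N^(-2ε)). The condition ε ≤ 1/2 makes N³ the smaller contribution. -/
lemma exists_sum_norm_sq_fourierCoef_le {f : ℝ × ℝ → ℝ} (hf : IntegrableOn f freqSquare)
    (hf0 : ∀ p ∈ freqSquare, 0 ≤ f p) {ε : ℝ} (hε : 0 < ε) (hε1 : ε ≤ 1 / 2)
    (hfε : IntegrableOn (fun p => f p ^ (1 + ε)) freqSquare) :
    ∃ C : ℝ, 0 ≤ C ∧ ∀ N : ℕ, 1 ≤ N → ∀ h : ℤ × ℤ,
      ∑ u ∈ box N, ∑ v ∈ box N, ‖fourierCoef f (u - v + h)‖ ^ 2 ≤ C * (N : ℝ) ^ (4 - 2 * ε) := by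
  set J := ∫ p in freqSquare, f p ^ (1 + ε)
  set I := ∫ p in freqSquare, f p
  have hJ : 0 ≤ J := setIntegral_nonneg measurableSet_freqSquare fun p hp => by
    have := hf0 p hp
    positivity
  have hI : 0 ≤ I := setIntegral_nonneg measurableSet_freqSquare hf0
  refine ⟨2 * (4 * Real.pi ^ 2 * I) + 2 * J ^ 2, by positivity, fun N hN h => ?_⟩
  have hN' : (1 : ℝ) ≤ N := by exact_mod_cast hN
  have hN0 : (0 : ℝ) < N := by linarith
  have hms : NullMeasurableSet {p | f p ≤ N} (volume.restrict freqSquare) :=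
    hf.1.aemeasurable.nullMeasurable measurableSet_Iic
  set f₁ : ℝ × ℝ → ℝ := Set.indicator {p | f p ≤ N} f with hf₁
  set f₂ : ℝ × ℝ → ℝ := Set.indicator {p | f p ≤ N}ᶜ f with hf₂
  have hi₁ : IntegrableOn f₁ freqSquare := Integrable.indicator₀ hf hms
  have hi₂ : IntegrableOn f₂ freqSquare := Integrable.indicator₀ hf hms.compl
  have hsum : ∀ w, fourierCoef f w = fourierCoef f₁ w + fourierCoef f₂ w := fun w => by
    rw [fourierCoef, fourierCoef, fourierCoef,
      ← integral_add (integrableOn_expChar_mul hi₁ w) (integrableOn_expChar_mul hi₂ w)]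
    refine integral_congr_ae (ae_of_all _ fun p => ?_)
    simp only [← mul_add, ← Complex.ofReal_add, hf₁, hf₂]
    rw [← Pi.add_apply, Set.indicator_self_add_compl]
  have hle₁ : ∀ p ∈ freqSquare, f₁ p ^ 2 ≤ N * f p := fun p hp => by
    have := hf0 p hp
    by_cases hp' : f p ≤ N
    · rw [hf₁, Set.indicator_of_mem (by exact hp'), sq]
      exact mul_le_mul_of_nonneg_right hp' this
    · rw [hf₁, Set.indicator_of_notMem (by exact hp')]
      simp only [ne_eq, OfNat.ofNat_ne_zero, not_false_eq_true, zero_pow]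
      positivity
  have hi₁2 : IntegrableOn (fun p => f₁ p ^ 2) freqSquare := by
    refine Integrable.mono' (hf.const_mul (N : ℝ)) (hi₁.1.pow 2) ?_
    refine (ae_restrict_iff' measurableSet_freqSquare).2 (ae_of_all _ fun p hp => ?_)
    rw [Real.norm_of_nonneg (sq_nonneg _)]
    exact hle₁ p hp
  have hB₁ : ∀ v, ∑ u ∈ box N, ‖fourierCoef f₁ (u - v + h)‖ ^ 2 ≤ 4 * Real.pi ^ 2 * (N * I) := fun v => by
    have hinj : Set.InjOn (fun u : ℤ × ℤ => u - v + h) (box N) := fun a _ b _ hab => by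
      simpa using hab
    rw [← Finset.sum_image (f := fun w => ‖fourierCoef f₁ w‖ ^ 2) hinj]
    refine (sum_norm_sq_fourierCoef_le hi₁ hi₁2 _).trans ?_
    refine mul_le_mul_of_nonneg_left ?_ (by positivity)
    rw [← integral_const_mul]
    exact setIntegral_mono_on hi₁2 (hf.const_mul _) measurableSet_freqSquare hle₁
  have hf₂0 : ∀ p ∈ freqSquare, 0 ≤ f₂ p := fun p hp => Set.indicator_apply_nonneg fun _ => hf0 p hp
  have hB₂ : ∀ w, ‖fourierCoef f₂ w‖ ≤ (N : ℝ) ^ (-ε) * J := fun w => by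
    refine (norm_fourierCoef_le hf₂0 w).trans ?_
    rw [← integral_const_mul]
    refine setIntegral_mono_on hi₂ (hfε.const_mul _) measurableSet_freqSquare fun p hp => ?_
    have h0 := hf0 p hp
    by_cases hp' : f p ≤ N
    · rw [hf₂, Set.indicator_of_notMem (by simpa using hp')]
      positivity
    · rw [hf₂, Set.indicator_of_mem (by simpa using hp')]
      push Not at hp'
      have hfp : 0 < f p := hN0.trans hp'
      rw [Real.rpow_add hfp, Real.rpow_one, Real.rpow_neg hN0.le, mul_comm (f p), ← mul_assoc]
      refine le_mul_of_one_le_left h0 ?_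
      rw [inv_mul_eq_div, one_le_div (by positivity)]
      exact Real.rpow_le_rpow hN0.le hp'.le hε.le
  have hpt : ∀ w, ‖fourierCoef f w‖ ^ 2 ≤
      2 * ‖fourierCoef f₁ w‖ ^ 2 + 2 * ((N : ℝ) ^ (-ε) * J) ^ 2 := fun w => by
    have h1 : ‖fourierCoef f w‖ ≤ ‖fourierCoef f₁ w‖ + (N : ℝ) ^ (-ε) * J := by
      rw [hsum w]
      exact (norm_add_le _ _).trans (by gcongr; exact hB₂ w)
    have h2 := pow_le_pow_left₀ (norm_nonneg _) h1 2
    nlinarith [sq_nonneg (‖fourierCoef f₁ w‖ - (N : ℝ) ^ (-ε) * J)]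
  have hcard : ((box N).card : ℝ) = (N : ℝ) ^ 2 := by rw [card_box]; push_cast; rfl
  have hN2 : ((N : ℝ) ^ (-ε)) ^ 2 * (N : ℝ) ^ 4 = (N : ℝ) ^ (4 - 2 * ε) := by
    rw [← Real.rpow_natCast, ← Real.rpow_natCast, ← Real.rpow_mul hN0.le, ← Real.rpow_add hN0]
    congr 1
    push_cast
    ring
  have hN3 : (N : ℝ) ^ 3 ≤ (N : ℝ) ^ (4 - 2 * ε) := by
    rw [← Real.rpow_natCast]
    exact Real.rpow_le_rpow_of_exponent_le hN' (by push_cast; linarith)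
  calc ∑ u ∈ box N, ∑ v ∈ box N, ‖fourierCoef f (u - v + h)‖ ^ 2
      ≤ ∑ u ∈ box N, ∑ v ∈ box N, (2 * ‖fourierCoef f₁ (u - v + h)‖ ^ 2 +
          2 * ((N : ℝ) ^ (-ε) * J) ^ 2) :=
        Finset.sum_le_sum fun u _ => Finset.sum_le_sum fun v _ => hpt _
    _ = 2 * ∑ v ∈ box N, ∑ u ∈ box N, ‖fourierCoef f₁ (u - v + h)‖ ^ 2 +
          2 * J ^ 2 * (((N : ℝ) ^ (-ε)) ^ 2 * (N : ℝ) ^ 4) := by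
        simp only [Finset.sum_add_distrib, Finset.sum_const, nsmul_eq_mul, hcard, ← Finset.mul_sum]
        rw [Finset.sum_comm]
        ring
    _ ≤ 2 * ∑ v ∈ box N, 4 * Real.pi ^ 2 * (N * I) + 2 * J ^ 2 * (N : ℝ) ^ (4 - 2 * ε) := by
        rw [hN2]
        gcongr with v _
        exact hB₁ v
    _ = 2 * (4 * Real.pi ^ 2 * I) * (N : ℝ) ^ 3 + 2 * J ^ 2 * (N : ℝ) ^ (4 - 2 * ε) := by
        rw [Finset.sum_const, nsmul_eq_mul, hcard]
        ring
    _ ≤ (2 * (4 * Real.pi ^ 2 * I) + 2 * J ^ 2) * (N : ℝ) ^ (4 - 2 * ε) := by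
        rw [add_mul]
        gcongr

end Fourier

/-! ### Strong law for sample autocovariances -/

section LawOfLargeNumbers

variable {Ω : Type*} [MeasurableSpace Ω] {P : Measure Ω}

lemma integral_sq_centeredSquareSum_le [IsProbabilityMeasure P] {Y : ℤ × ℤ → Ω → ℝ}
    (hY : IsGaussianProcess Y P) (h0 : ∀ u, ∫ ω, Y u ω ∂P = 0) {s : ℝ}
    (hs : ∀ u, ∫ ω, Y u ω ^ 2 ∂P = s) (D : Finset (ℤ × ℤ)) :
    Integrable (fun ω => (∑ u ∈ D, (Y u ω ^ 2 - s)) ^ 2) P ∧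
    ∫ ω, (∑ u ∈ D, (Y u ω ^ 2 - s)) ^ 2 ∂P =
      2 * ∑ u ∈ D, ∑ v ∈ D, (∫ ω, Y u ω * Y v ω ∂P) ^ 2 := by
  have hm4 : ∀ u, MemLp (fun ω => Y u ω ^ 2) 2 P := fun u => by
    have h := (hY.hasGaussianLaw_eval u).memLp (p := 4) (by simp)
    have hm := (hY.aemeasurable u).aestronglyMeasurable
    refine (memLp_two_iff_integrable_sq (by fun_prop)).2 ?_
    refine (h.integrable_norm_pow (p := 4) (by norm_num)).congr (ae_of_all _ fun ω => ?_)
    simp only [Real.norm_eq_abs, ← pow_mul]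
    exact Even.pow_abs (by decide) _
  have hm : ∀ u, MemLp (fun ω => Y u ω ^ 2 - s) 2 P := fun u => (hm4 u).sub (memLp_const s)
  have hprod : ∀ u v, Integrable (fun ω => (Y u ω ^ 2 - s) * (Y v ω ^ 2 - s)) P :=
    fun u v => (hm u).integrable_mul (hm v)
  have hval : ∀ u v, ∫ ω, (Y u ω ^ 2 - s) * (Y v ω ^ 2 - s) ∂P =
      2 * (∫ ω, Y u ω * Y v ω ∂P) ^ 2 := fun u v => by
    have e := integral_sq_mul_sq_of_hasGaussianLaw (hY.hasGaussianLaw_prodMk (s := u) (t := v))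
      (h0 u) (h0 v)
    rw [hs, hs] at e
    have iu := (hm4 u).integrable (by norm_num)
    have iv := (hm4 v).integrable (by norm_num)
    have iuv : Integrable (fun ω => Y u ω ^ 2 * Y v ω ^ 2) P := (hm4 u).integrable_mul (hm4 v)
    have h1 : ∫ ω, (Y u ω ^ 2 - s) * (Y v ω ^ 2 - s) ∂P =
        ∫ ω, (Y u ω ^ 2 * Y v ω ^ 2 - (s * Y u ω ^ 2 + s * Y v ω ^ 2 - s ^ 2)) ∂P :=
      integral_congr_ae (ae_of_all _ fun ω => by simp only []; ring)
    have i1 : Integrable (fun ω => s * Y u ω ^ 2 + s * Y v ω ^ 2) P :=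
      (iu.const_mul s).add (iv.const_mul s)
    have i2 : Integrable (fun ω => s * Y u ω ^ 2 + s * Y v ω ^ 2 - s ^ 2) P :=
      i1.sub (integrable_const _)
    rw [h1, integral_sub iuv i2, integral_sub i1 (integrable_const _),
      integral_add (iu.const_mul s) (iv.const_mul s), integral_const_mul, integral_const_mul, hs,
      hs, e, integral_const]
    simp
    ring
  have e : ∀ ω, (∑ u ∈ D, (Y u ω ^ 2 - s)) ^ 2 =
      ∑ u ∈ D, ∑ v ∈ D, (Y u ω ^ 2 - s) * (Y v ω ^ 2 - s) := fun ω => by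
    rw [sq, Finset.sum_mul_sum]
  simp_rw [e]
  refine ⟨integrable_finsetSum _ fun u _ => integrable_finsetSum _ fun v _ => hprod u v, ?_⟩
  rw [integral_finsetSum _ fun u _ => integrable_finsetSum _ fun v _ => hprod u v, Finset.mul_sum]
  refine Finset.sum_congr rfl fun u _ => ?_
  rw [integral_finsetSum _ fun v _ => hprod u v, Finset.mul_sum]
  exact Finset.sum_congr rfl fun v _ => hval u v

lemma integral_sq_sum_eq [IsProbabilityMeasure P] {Y : ℤ × ℤ → Ω → ℝ}
    (hY : IsGaussianProcess Y P) (D : Finset (ℤ × ℤ)) :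
    Integrable (fun ω => (∑ u ∈ D, Y u ω) ^ 2) P ∧
    ∫ ω, (∑ u ∈ D, Y u ω) ^ 2 ∂P = ∑ u ∈ D, ∑ v ∈ D, ∫ ω, Y u ω * Y v ω ∂P := by
  have hprod : ∀ u v, Integrable (fun ω => Y u ω * Y v ω) P := fun u v =>
    (hY.hasGaussianLaw_eval u).memLp_two.integrable_mul (hY.hasGaussianLaw_eval v).memLp_two
  have e : ∀ ω, (∑ u ∈ D, Y u ω) ^ 2 = ∑ u ∈ D, ∑ v ∈ D, Y u ω * Y v ω := fun ω => by
    rw [sq, Finset.sum_mul_sum]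
  simp_rw [e]
  refine ⟨integrable_finsetSum _ fun u _ => integrable_finsetSum _ fun v _ => hprod u v, ?_⟩
  rw [integral_finsetSum _ fun u _ => integrable_finsetSum _ fun v _ => hprod u v]
  exact Finset.sum_congr rfl fun u _ => integral_finsetSum _ fun v _ => hprod u v

/-- Both averages converge along N = j^q by second moments. Sums of squares increase with the
window, so they interpolate. The linear sums do not; they are recovered as differences of two sums
of squares. -/
lemma ae_tendsto_average_of_isGaussianProcess [IsProbabilityMeasure P] {Y : ℤ × ℤ → Ω → ℝ}
    (hY : IsGaussianProcess Y P) (h0 : ∀ u, ∫ ω, Y u ω ∂P = 0) {s : ℝ}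
    (hs : ∀ u, ∫ ω, Y u ω ^ 2 ∂P = s) {C a : ℝ} (hC : 0 ≤ C) (ha : 0 < a)
    (hb : ∀ N : ℕ, 1 ≤ N →
      ∑ u ∈ box N, ∑ v ∈ box N, (∫ ω, Y u ω * Y v ω ∂P) ^ 2 ≤ C * (N : ℝ) ^ (4 - a))
    {D : ℕ → Finset (ℤ × ℤ)} (hD : Monotone D) (hDbox : ∀ N, D N ⊆ box N)
    (hcard : Tendsto (fun N : ℕ => ((D N).card : ℝ) / (N : ℝ) ^ 2) atTop (𝓝 1)) :
    ∀ᵐ ω ∂P, Tendsto (fun N : ℕ => (∑ u ∈ D N, Y u ω ^ 2) / (N : ℝ) ^ 2) atTop (𝓝 s) ∧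
      Tendsto (fun N : ℕ => (∑ u ∈ D N, Y u ω) / (N : ℝ) ^ 2) atTop (𝓝 0) := by
  -- With q a > 2 the subsequence serves both decay rates: a for the squares and a / 2 for the
  -- linear sums.
  obtain ⟨q, hq⟩ := exists_nat_gt (2 / a)
  have hq0 : 0 < q := by
    have : (0 : ℝ) < q := (by positivity : (0 : ℝ) < 2 / a).trans hq
    exact_mod_cast this
  rw [div_lt_iff₀ ha] at hq
  have hsub : ∀ N : ℕ, 1 ≤ N →
      ∑ u ∈ D N, ∑ v ∈ D N, (∫ ω, Y u ω * Y v ω ∂P) ^ 2 ≤ C * (N : ℝ) ^ (4 - a) := fun N hN => by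
    refine le_trans ?_ (hb N hN)
    refine (Finset.sum_le_sum fun u _ => Finset.sum_le_sum_of_subset_of_nonneg (hDbox N)
      fun v _ _ => sq_nonneg _).trans ?_
    exact Finset.sum_le_sum_of_subset_of_nonneg (hDbox N)
      fun u _ _ => Finset.sum_nonneg fun v _ => sq_nonneg _
  have hcardle : ∀ N, ((D N).card : ℝ) ≤ (N : ℝ) ^ 2 := fun N => by
    have := Finset.card_le_card (hDbox N)
    rw [card_box] at this
    exact_mod_cast this
  have hA := ae_tendsto_zero_of_integral_sq_le (P := P)
    (A := fun N ω => (∑ u ∈ D N, (Y u ω ^ 2 - s)) / (N : ℝ) ^ 2) (C := 2 * C) (a := a) (q := q)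
    (fun N => by
      simp_rw [div_pow]
      exact (integral_sq_centeredSquareSum_le hY h0 hs (D N)).1.div_const _)
    (fun N hN => by
      have hN0 : (0 : ℝ) < N := by exact_mod_cast hN
      simp_rw [div_pow]
      rw [integral_div, (integral_sq_centeredSquareSum_le hY h0 hs (D N)).2,
        div_le_iff₀ (by positivity)]
      have e : (N : ℝ) ^ (-a) * ((N : ℝ) ^ 2) ^ 2 = (N : ℝ) ^ (4 - a) := by
        rw [← pow_mul, ← Real.rpow_natCast, ← Real.rpow_add hN0]
        congr 1
        push_cast
        ring
      rw [mul_assoc (2 * C), e, mul_assoc]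
      exact mul_le_mul_of_nonneg_left (hsub N hN) (by norm_num)) (by linarith)
  have hB := ae_tendsto_zero_of_integral_sq_le (P := P)
    (A := fun N ω => (∑ u ∈ D N, Y u ω) / (N : ℝ) ^ 2) (C := √C) (a := a / 2) (q := q)
    (fun N => by
      simp_rw [div_pow]
      exact (integral_sq_sum_eq hY (D N)).1.div_const _)
    (fun N hN => by
      have hN0 : (0 : ℝ) < N := by exact_mod_cast hN
      simp_rw [div_pow]
      rw [integral_div, (integral_sq_sum_eq hY (D N)).2, div_le_iff₀ (by positivity)]
      -- Cauchy–Schwarz over at most N⁴ pairs halves the decay exponent.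
      have hcs : (∑ u ∈ D N, ∑ v ∈ D N, ∫ ω, Y u ω * Y v ω ∂P) ^ 2 ≤
          (N : ℝ) ^ 4 * (C * (N : ℝ) ^ (4 - a)) := by
        have h1 := sq_sum_le_card_mul_sum_sq (s := D N ×ˢ D N)
          (f := fun x => ∫ ω, Y x.1 ω * Y x.2 ω ∂P)
        rw [Finset.sum_product, Finset.sum_product, Finset.card_product] at h1
        refine h1.trans ?_
        refine mul_le_mul ?_ (hsub N hN) (Finset.sum_nonneg fun u _ =>
          Finset.sum_nonneg fun v _ => sq_nonneg _) (by positivity)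
        push_cast
        calc ((D N).card : ℝ) * (D N).card ≤ (N : ℝ) ^ 2 * (N : ℝ) ^ 2 := by
              gcongr <;> exact hcardle N
          _ = _ := by ring
      refine (Real.le_sqrt_of_sq_le hcs).trans_eq ?_
      rw [← mul_assoc, mul_comm _ C, mul_assoc, Real.sqrt_mul hC, mul_assoc]
      congr 1
      rw [Real.sqrt_eq_rpow, ← pow_mul, ← Real.rpow_natCast,
        ← Real.rpow_add hN0, ← Real.rpow_mul hN0.le, ← Real.rpow_add hN0]
      congr 1
      push_cast
      ring) (by linarith)
  have hcq := hcard.comp (tendsto_pow_atTop (α := ℕ) hq0.ne')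
  filter_upwards [hA, hB] with ω hAω hBω
  have hsq : Tendsto (fun N : ℕ => (∑ u ∈ D N, Y u ω ^ 2) / (N : ℝ) ^ 2) atTop (𝓝 s) := by
    refine tendsto_div_sq_of_monotone_of_pow_subseq (S := fun N => ∑ u ∈ D N, Y u ω ^ 2)
      (fun a b hab => Finset.sum_le_sum_of_subset_of_nonneg (hD hab) fun _ _ _ => sq_nonneg _) hq0 ?_
    have := hAω.add (hcq.const_mul s)
    rw [zero_add, mul_one] at this
    refine this.congr fun j => ?_
    simp only [Function.comp_apply, Finset.sum_sub_distrib, Finset.sum_const, nsmul_eq_mul]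
    ring
  -- The sums of (Y + 1)² are monotone in the window as well, and 2Y = (Y + 1)² - Y² - 1.
  have hsq1 : Tendsto (fun N : ℕ => (∑ u ∈ D N, (Y u ω + 1) ^ 2) / (N : ℝ) ^ 2) atTop
      (𝓝 (s + 1)) := by
    refine tendsto_div_sq_of_monotone_of_pow_subseq (S := fun N => ∑ u ∈ D N, (Y u ω + 1) ^ 2)
      (fun a b hab => Finset.sum_le_sum_of_subset_of_nonneg (hD hab) fun _ _ _ => sq_nonneg _) hq0 ?_
    have := (hsq.comp (tendsto_pow_atTop (α := ℕ) hq0.ne')).add ((hBω.const_mul 2).add hcq)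
    rw [mul_zero, zero_add] at this
    refine this.congr fun j => ?_
    simp only [Function.comp_apply, add_sq, Finset.sum_add_distrib, Finset.sum_const, nsmul_eq_mul,
      mul_one, one_pow, ← Finset.mul_sum]
    ring
  refine ⟨hsq, ?_⟩
  have := ((hsq1.sub hsq).sub hcard).const_mul (1 / 2)
  rw [show (1 / 2 : ℝ) * (s + 1 - s - 1) = 0 by ring] at this
  refine this.congr fun N => ?_
  simp only [add_sq, Finset.sum_add_distrib, Finset.sum_const, nsmul_eq_mul,
      mul_one, one_pow, ← Finset.mul_sum]
  ring

/-- The sites `u` of the window for which `u + h` is also in the window. -/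
def lagBox (h : ℤ × ℤ) (N : ℕ) : Finset (ℤ × ℤ) := {u ∈ box N | u + h ∈ box N}

lemma lagBox_mono (h : ℤ × ℤ) : Monotone (lagBox h) := fun a b hab u hu => by
  rw [lagBox, Finset.mem_filter] at hu ⊢
  exact ⟨box_mono hab hu.1, box_mono hab hu.2⟩

lemma lagBox_subset (h : ℤ × ℤ) (N : ℕ) : lagBox h N ⊆ box N := Finset.filter_subset _ _

lemma tendsto_card_lagBox (h : ℤ × ℤ) :
    Tendsto (fun N : ℕ => ((lagBox h N).card : ℝ) / (N : ℝ) ^ 2) atTop (𝓝 1) := by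
  have hone : ∀ k : ℤ, Tendsto (fun N : ℕ => ((N : ℝ) - |k|) / N) atTop (𝓝 1) := fun k => by
    have h1 := (tendsto_const_div_atTop_nhds_zero_nat (|k| : ℝ)).const_sub 1
    rw [sub_zero] at h1
    refine h1.congr' ?_
    filter_upwards [eventually_gt_atTop 0] with N hN
    have : (N : ℝ) ≠ 0 := by exact_mod_cast hN.ne'
    push_cast
    field_simp
  have hlim := (hone h.1).mul (hone h.2)
  rw [mul_one] at hlim
  refine hlim.congr' ?_
  filter_upwards [eventually_ge_atTop (h.1.natAbs), eventually_ge_atTop (h.2.natAbs)] with N h1 h2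
  -- Once N ≥ |h₁|, |h₂|, the overlap of the window with its translate is a rectangle with sides N -
  -- |h₁| and N - |h₂|.
  have e : lagBox h N = Finset.Icc (max 1 (1 - h.1)) (min (N : ℤ) (N - h.1)) ×ˢ
      Finset.Icc (max 1 (1 - h.2)) (min (N : ℤ) (N - h.2)) := by
    ext u
    simp only [lagBox, box, Finset.mem_filter, Finset.mem_product, Finset.mem_Icc, Prod.fst_add,
      Prod.snd_add]
    omega
  have c1 : ∀ k : ℤ, k.natAbs ≤ N →
      (((Finset.Icc (max 1 (1 - k)) (min (N : ℤ) (N - k))).card : ℤ)) = N - |k| := fun k hk => by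
    rw [Int.card_Icc]
    rcases abs_cases k with hk' | hk' <;> omega
  have c1' : ∀ k : ℤ, k.natAbs ≤ N →
      (((Finset.Icc (max 1 (1 - k)) (min (N : ℤ) (N - k))).card : ℝ)) = N - |k| := fun k hk => by
    exact_mod_cast congrArg (Int.cast (R := ℝ)) (c1 k hk)
  rw [e, Finset.card_product, Nat.cast_mul, c1' _ h1, c1' _ h2, div_mul_div_comm, ← sq]

/-- Polarization: the strong law is applied to the Gaussian field α Z_u + β Z_{u+h} for (α, β) = (1,
0), (0, 1), (1, 1). Its covariance mixes γ at the arguments u - v, u - v + h and u - v - h, which is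
why the bound on squared covariances is required for every shift. -/
lemma ae_tendsto_lag_averages [IsProbabilityMeasure P] {Z : ℤ × ℤ → Ω → ℝ}
    (hZ : IsGaussianProcess Z P) (h0 : ∀ u, ∫ ω, Z u ω ∂P = 0) {γ : ℤ × ℤ → ℝ}
    (hγ : ∀ u v, ∫ ω, Z u ω * Z v ω ∂P = γ (u - v)) {C a : ℝ} (hC : 0 ≤ C) (ha : 0 < a)
    (hb : ∀ N : ℕ, 1 ≤ N → ∀ h : ℤ × ℤ,
      ∑ u ∈ box N, ∑ v ∈ box N, γ (u - v + h) ^ 2 ≤ C * (N : ℝ) ^ (4 - a)) (h : ℤ × ℤ) :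
    ∀ᵐ ω ∂P,
      Tendsto (fun N : ℕ => (∑ u ∈ lagBox h N, Z u ω * Z (u + h) ω) / (N : ℝ) ^ 2) atTop
        (𝓝 (γ h)) ∧
      Tendsto (fun N : ℕ => (∑ u ∈ lagBox h N, Z u ω) / (N : ℝ) ^ 2) atTop (𝓝 0) ∧
      Tendsto (fun N : ℕ => (∑ u ∈ lagBox h N, Z (u + h) ω) / (N : ℝ) ^ 2) atTop (𝓝 0) := by
  have hprod : ∀ u v, Integrable (fun ω => Z u ω * Z v ω) P := fun u v =>
    (hZ.hasGaussianLaw_eval u).memLp_two.integrable_mul (hZ.hasGaussianLaw_eval v).memLp_two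
  have hi : ∀ u, Integrable (Z u) P := fun u => (hZ.hasGaussianLaw_eval u).integrable
  have hsymm : γ (-h) = γ h := by
    have h1 := hγ 0 h
    have h2 := hγ h 0
    rw [zero_sub] at h1
    rw [sub_zero] at h2
    rw [← h1, ← h2]
    exact integral_congr_ae (ae_of_all _ fun ω => mul_comm _ _)
  have hcov : ∀ (α β : ℝ) (u v : ℤ × ℤ),
      ∫ ω, (α * Z u ω + β * Z (u + h) ω) * (α * Z v ω + β * Z (v + h) ω) ∂P =
        (α ^ 2 + β ^ 2) * γ (u - v + 0) + α * β * γ (u - v + h) + α * β * γ (u - v + -h) :=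
      fun α β u v => by
    have e : ∀ ω, (α * Z u ω + β * Z (u + h) ω) * (α * Z v ω + β * Z (v + h) ω) =
        α ^ 2 * (Z u ω * Z v ω) + α * β * (Z u ω * Z (v + h) ω) +
          (α * β * (Z (u + h) ω * Z v ω) + β ^ 2 * (Z (u + h) ω * Z (v + h) ω)) := fun ω => by ring
    simp_rw [e]
    rw [integral_add (((hprod _ _).const_mul _).fun_add ((hprod _ _).const_mul _))
        (((hprod _ _).const_mul _).fun_add ((hprod _ _).const_mul _)),
      integral_add ((hprod _ _).const_mul _) ((hprod _ _).const_mul _),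
      integral_add ((hprod _ _).const_mul _) ((hprod _ _).const_mul _)]
    simp_rw [integral_const_mul, hγ]
    rw [add_sub_add_right_eq_sub, ← sub_sub, ← sub_eq_add_neg, add_zero, add_sub_right_comm]
    ring
  have main : ∀ α β : ℝ, ∀ᵐ ω ∂P,
      Tendsto (fun N : ℕ => (∑ u ∈ lagBox h N, (α * Z u ω + β * Z (u + h) ω) ^ 2) / (N : ℝ) ^ 2)
        atTop (𝓝 ((α ^ 2 + β ^ 2) * γ 0 + 2 * (α * β) * γ h)) ∧
      Tendsto (fun N : ℕ => (∑ u ∈ lagBox h N, (α * Z u ω + β * Z (u + h) ω)) / (N : ℝ) ^ 2)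
        atTop (𝓝 0) := fun α β => by
    refine ae_tendsto_average_of_isGaussianProcess
      (C := 3 * ((α ^ 2 + β ^ 2) ^ 2 + 2 * (α * β) ^ 2) * C) (a := a)
      (IsGaussianProcess.linear_comb hZ α β h) (fun u => ?_) (fun u => ?_) (by positivity) ha
      (fun N hN => ?_) (lagBox_mono h) (lagBox_subset h) (tendsto_card_lagBox h)
    · rw [integral_add ((hi _).const_mul _) ((hi _).const_mul _), integral_const_mul,
        integral_const_mul, h0, h0]
      ring
    · simp_rw [sq (α * Z u _ + _)]
      rw [hcov, sub_self, zero_add, zero_add, zero_add, hsymm]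
      ring
    · simp_rw [hcov]
      calc _ ≤ ∑ u ∈ box N, ∑ v ∈ box N, (3 * (α ^ 2 + β ^ 2) ^ 2 * γ (u - v + 0) ^ 2 +
            3 * (α * β) ^ 2 * γ (u - v + h) ^ 2 + 3 * (α * β) ^ 2 * γ (u - v + -h) ^ 2) := by
            refine Finset.sum_le_sum fun u _ => Finset.sum_le_sum fun v _ => ?_
            have h3 : ∀ x y z : ℝ, (x + y + z) ^ 2 ≤ 3 * x ^ 2 + 3 * y ^ 2 + 3 * z ^ 2 :=
              fun x y z => by nlinarith [sq_nonneg (x - y), sq_nonneg (y - z), sq_nonneg (x - z)]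
            refine (h3 _ _ _).trans_eq ?_
            ring
        _ = 3 * (α ^ 2 + β ^ 2) ^ 2 * ∑ u ∈ box N, ∑ v ∈ box N, γ (u - v + 0) ^ 2 +
            3 * (α * β) ^ 2 * ∑ u ∈ box N, ∑ v ∈ box N, γ (u - v + h) ^ 2 +
            3 * (α * β) ^ 2 * ∑ u ∈ box N, ∑ v ∈ box N, γ (u - v + -h) ^ 2 := by
            simp only [Finset.sum_add_distrib, Finset.mul_sum]
        _ ≤ 3 * (α ^ 2 + β ^ 2) ^ 2 * (C * (N : ℝ) ^ (4 - a)) +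
            3 * (α * β) ^ 2 * (C * (N : ℝ) ^ (4 - a)) +
            3 * (α * β) ^ 2 * (C * (N : ℝ) ^ (4 - a)) := by
            gcongr <;> exact hb N hN _
        _ = _ := by ring
  filter_upwards [main 1 0, main 0 1, main 1 1] with ω h10 h01 h11
  refine ⟨?_, ?_, ?_⟩
  · have := ((h11.1.sub h10.1).sub h01.1).const_mul (1 / 2)
    rw [show (1 / 2 : ℝ) * ((1 ^ 2 + 1 ^ 2) * γ 0 + 2 * (1 * 1) * γ h -
      ((1 ^ 2 + 0 ^ 2) * γ 0 + 2 * (1 * 0) * γ h) -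
      ((0 ^ 2 + 1 ^ 2) * γ 0 + 2 * (0 * 1) * γ h)) = γ h by ring] at this
    refine this.congr fun N => ?_
    rw [← sub_div, ← sub_div, ← Finset.sum_sub_distrib, ← Finset.sum_sub_distrib, ← mul_div_assoc,
      Finset.mul_sum]
    congr 1
    refine Finset.sum_congr rfl fun u _ => ?_
    ring
  · simpa using h10.2
  · simpa using h01.2

end LawOfLargeNumbers

/-! ### The periodogram and its weak convergence -/

section Periodogram

lemma sum_Icc_sum_Icc_eq_sum_box {M : Type*} [AddCommMonoid M] (N : ℕ) (F : ℤ × ℤ → M) :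
    ∑ k ∈ Finset.Icc 1 N, ∑ l ∈ Finset.Icc 1 N, F ((k : ℤ), (l : ℤ)) = ∑ u ∈ box N, F u := by
  have h1 : ∀ g : ℤ → M, ∑ k ∈ Finset.Icc 1 N, g (k : ℤ) = ∑ k ∈ Finset.Icc 1 (N : ℤ), g k := fun g => by
    have e : Finset.Icc 1 (N : ℤ) = (Finset.Icc 1 N).map Nat.castEmbedding := by
      ext k
      simp only [Finset.mem_Icc, Finset.mem_map, Nat.castEmbedding_apply]
      constructor
      · intro hk
        exact ⟨k.toNat, by omega, by omega⟩
      · rintro ⟨n, hn, rfl⟩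
        omega
    rw [e, Finset.sum_map]
    rfl
  rw [box, Finset.sum_product, ← h1 fun k => ∑ l ∈ Finset.Icc 1 (N : ℤ), F (k, l)]
  exact Finset.sum_congr rfl fun k _ => h1 fun l => F (k, l)

lemma sampleMean_eq (N : ℕ) (x : ℤ × ℤ → ℝ) :
    sampleMean N x = (∑ u ∈ box N, x u) / (N : ℝ) ^ 2 := by
  rw [sampleMean, sum_Icc_sum_Icc_eq_sum_box, one_div_mul_eq_div]

lemma periodogram_eq (N : ℕ) (x : ℤ × ℤ → ℝ) (p : ℝ × ℝ) :
    periodogram N x p = 1 / (N : ℝ) ^ 2 *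
      ‖∑ u ∈ box N, ((x u - sampleMean N x : ℝ) : ℂ) * expChar u p‖ ^ 2 := by
  rw [periodogram, ← sum_Icc_sum_Icc_eq_sum_box]
  congr 3
  refine Finset.sum_congr rfl fun k _ => Finset.sum_congr rfl fun l _ => ?_
  rw [mul_comm, expChar]
  norm_cast

lemma periodogram_nonneg (N : ℕ) (x : ℤ × ℤ → ℝ) (p : ℝ × ℝ) : 0 ≤ periodogram N x p := by
  rw [periodogram_eq]
  positivity

lemma continuous_periodogram (N : ℕ) (x : ℤ × ℤ → ℝ) : Continuous (periodogram N x) := by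
  have : periodogram N x = _ := funext fun p => periodogram_eq N x p
  rw [this]
  fun_prop

lemma integral_periodogram_mul_expChar (N : ℕ) (x : ℤ × ℤ → ℝ) (h : ℤ × ℤ) :
    ∫ p in freqSquare, (periodogram N x p : ℂ) * expChar h p =
      4 * (Real.pi : ℂ) ^ 2 * (((∑ u ∈ lagBox h N,
        (x u - sampleMean N x) * (x (u + h) - sampleMean N x)) / (N : ℝ) ^ 2 : ℝ) : ℂ) := by
  have e : ∀ p, (periodogram N x p : ℂ) * expChar h p = (((1 / (N : ℝ) ^ 2 : ℝ)) : ℂ) *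
      (((‖∑ u ∈ box N, ((x u - sampleMean N x : ℝ) : ℂ) * expChar u p‖ ^ 2 : ℝ) : ℂ) *
        expChar h p) := fun p => by
    rw [periodogram_eq, Complex.ofReal_mul, mul_assoc]
  simp_rw [e]
  rw [integral_const_mul, integral_normSq_sum_mul_expChar]
  simp only [Complex.conj_ofReal, ← Complex.ofReal_mul, ← Complex.ofReal_sum]
  rw [lagBox]
  push_cast
  ring

/-- Replacing the true mean m by the sample mean m + z changes the lagged average only by terms
carrying a factor z, and z → 0 by the lag-zero hypothesis. -/
lemma tendsto_integral_periodogram_mul_expChar {x : ℤ × ℤ → ℝ} {m : ℝ} {γ : ℤ × ℤ → ℝ}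
    (hx : ∀ h : ℤ × ℤ,
      Tendsto (fun N : ℕ => (∑ u ∈ lagBox h N, (x u - m) * (x (u + h) - m)) / (N : ℝ) ^ 2) atTop
        (𝓝 (γ h)) ∧
      Tendsto (fun N : ℕ => (∑ u ∈ lagBox h N, (x u - m)) / (N : ℝ) ^ 2) atTop (𝓝 0) ∧
      Tendsto (fun N : ℕ => (∑ u ∈ lagBox h N, (x (u + h) - m)) / (N : ℝ) ^ 2) atTop (𝓝 0))
    (h : ℤ × ℤ) :
    Tendsto (fun N : ℕ => ∫ p in freqSquare, (periodogram N x p : ℂ) * expChar h p) atTop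
      (𝓝 (4 * (Real.pi : ℂ) ^ 2 * (γ h : ℂ))) := by
  simp_rw [integral_periodogram_mul_expChar]
  refine Tendsto.const_mul _ ((Complex.continuous_ofReal.tendsto _).comp ?_)
  have hbox : ∀ N, lagBox 0 N = box N := fun N => by simp [lagBox]
  have hmean := (hx 0).2.1
  simp only [hbox] at hmean
  obtain ⟨h1, h2, h3⟩ := hx h
  have hlim := (h1.sub (hmean.mul (h2.add h3))).add ((hmean.pow 2).mul (tendsto_card_lagBox h))
  rw [show γ h - 0 * (0 + 0) + 0 ^ 2 * 1 = γ h by ring] at hlim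
  refine hlim.congr' ?_
  filter_upwards [eventually_gt_atTop 0] with N hN
  have hN' : (N : ℝ) ≠ 0 := by exact_mod_cast hN.ne'
  set z : ℝ := (∑ u ∈ box N, (x u - m)) / (N : ℝ) ^ 2 with hz
  have e : sampleMean N x = m + z := by
    rw [sampleMean_eq, hz, Finset.sum_sub_distrib, Finset.sum_const, card_box, nsmul_eq_mul]
    push_cast
    field_simp
    ring
  rw [e]
  have e2 : ∀ u, (x u - (m + z)) * (x (u + h) - (m + z)) =
      (x u - m) * (x (u + h) - m) - z * (x u - m) - z * (x (u + h) - m) + z ^ 2 := fun u => by ring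
  simp_rw [e2]
  have e3 : ∑ u ∈ lagBox h N, ((x u - m) * (x (u + h) - m) - z * (x u - m) - z * (x (u + h) - m) +
      z ^ 2) = ∑ u ∈ lagBox h N, (x u - m) * (x (u + h) - m) - z * ∑ u ∈ lagBox h N, (x u - m) -
        z * ∑ u ∈ lagBox h N, (x (u + h) - m) + (lagBox h N).card * z ^ 2 := by
    simp only [Finset.sum_add_distrib, Finset.sum_sub_distrib, Finset.mul_sum, mul_sub,
      Finset.sum_const, nsmul_eq_mul]
    ring
  rw [e3]
  ring

/-- The point of the two-dimensional torus with angles `p`. -/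
def torusPoint (p : ℝ × ℝ) : UnitAddTorus (Fin 2) :=
  ![((p.1 / (2 * Real.pi) : ℝ) : UnitAddCircle), ((p.2 / (2 * Real.pi) : ℝ) : UnitAddCircle)]

@[fun_prop]
lemma continuous_torusPoint : Continuous torusPoint := by
  refine continuous_pi fun i => ?_
  fin_cases i
  · exact (AddCircle.continuous_mk' 1).comp (by fun_prop)
  · exact (AddCircle.continuous_mk' 1).comp (by fun_prop)

lemma fourier_coe_div_two_pi (k : ℤ) (x : ℝ) :
    fourier k ((x / (2 * Real.pi) : ℝ) : UnitAddCircle) =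
      Complex.exp (Complex.I * ((k : ℂ) * (x : ℂ))) := by
  rw [fourier_coe_apply]
  congr 1
  have : (Real.pi : ℂ) ≠ 0 := by exact_mod_cast Real.pi_ne_zero
  push_cast
  field_simp

lemma mFourier_torusPoint (n : Fin 2 → ℤ) (p : ℝ × ℝ) :
    UnitAddTorus.mFourier n (torusPoint p) = expChar (n 0, n 1) p := by
  have : UnitAddTorus.mFourier n (torusPoint p) =
      ∏ i, fourier (n i) (torusPoint p i) := rfl
  rw [this, Fin.prod_univ_two]
  simp only [torusPoint, Matrix.cons_val_zero, Matrix.cons_val_one]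
  rw [fourier_coe_div_two_pi, fourier_coe_div_two_pi, ← Complex.exp_add, ← mul_add]
  rfl

section WeakConvergence

variable {x : ℤ × ℤ → ℝ} {f : ℝ × ℝ → ℝ}

lemma integrableOn_mul_torus {F : ℝ × ℝ → ℝ} (hF : IntegrableOn F freqSquare)
    (G : C(UnitAddTorus (Fin 2), ℂ)) :
    IntegrableOn (fun p => (F p : ℂ) * G (torusPoint p)) freqSquare := by
  refine Integrable.mul_bdd (c := ‖G‖) hF.ofReal ?_ (ae_of_all _ fun p => G.norm_coe_le_norm _)
  exact (G.continuous.comp continuous_torusPoint).aestronglyMeasurable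

lemma norm_integral_mul_torus_le {F : ℝ × ℝ → ℝ} (hF : IntegrableOn F freqSquare)
    (hF0 : ∀ p ∈ freqSquare, 0 ≤ F p) (G : C(UnitAddTorus (Fin 2), ℂ)) :
    ‖∫ p in freqSquare, (F p : ℂ) * G (torusPoint p)‖ ≤ (∫ p in freqSquare, F p) * ‖G‖ := by
  rw [← integral_mul_const]
  refine norm_integral_le_of_norm_le (Integrable.mul_const hF _) ?_
  refine (ae_restrict_iff' measurableSet_freqSquare).2 (ae_of_all _ fun p hp => ?_)
  rw [norm_mul, Complex.norm_real, Real.norm_of_nonneg (hF0 p hp)]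
  exact mul_le_mul_of_nonneg_left (G.norm_coe_le_norm _) (hF0 p hp)

lemma integrableOn_periodogram (N : ℕ) (x : ℤ × ℤ → ℝ) : IntegrableOn (periodogram N x) freqSquare :=
  (continuous_periodogram N x).integrableOn_freqSquare

lemma tendsto_integral_periodogram
    (hconv : ∀ h, Tendsto (fun N : ℕ => ∫ p in freqSquare, (periodogram N x p : ℂ) * expChar h p)
      atTop (𝓝 (4 * (Real.pi : ℂ) ^ 2 * fourierCoef f h))) :
    Tendsto (fun N : ℕ => ∫ p in freqSquare, periodogram N x p) atTop
      (𝓝 (4 * Real.pi ^ 2 * ∫ p in freqSquare, f p)) := by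
  have h := hconv 0
  have e0 : ∀ p, expChar 0 p = 1 := fun p => by simp [expChar]
  simp only [e0, mul_one, fourierCoef, one_mul, integral_complex_ofReal] at h
  have := (Complex.continuous_re.tendsto _).comp h
  simpa [Function.comp_def, ← Complex.ofReal_pow] using this

lemma tendsto_integral_periodogram_mul_of_mem_span
    (hf : IntegrableOn f freqSquare)
    (hconv : ∀ h, Tendsto (fun N : ℕ => ∫ p in freqSquare, (periodogram N x p : ℂ) * expChar h p)
      atTop (𝓝 (4 * (Real.pi : ℂ) ^ 2 * fourierCoef f h)))
    {G : C(UnitAddTorus (Fin 2), ℂ)}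
    (hG : G ∈ Submodule.span ℂ (Set.range (UnitAddTorus.mFourier (d := Fin 2)))) :
    Tendsto (fun N : ℕ => ∫ p in freqSquare, (periodogram N x p : ℂ) * G (torusPoint p)) atTop
      (𝓝 (4 * (Real.pi : ℂ) ^ 2 * ∫ p in freqSquare, (f p : ℂ) * G (torusPoint p))) := by
  induction hG using Submodule.span_induction with
  | mem G hG =>
    obtain ⟨n, rfl⟩ := hG
    simp_rw [mFourier_torusPoint, mul_comm (f _ : ℂ)]
    exact hconv _
  | zero => simp
  | add G₁ G₂ _ _ h₁ h₂ =>
    simp only [ContinuousMap.add_apply, mul_add]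
    rw [integral_add (integrableOn_mul_torus hf G₁) (integrableOn_mul_torus hf G₂), mul_add]
    refine (h₁.add h₂).congr fun N => ?_
    rw [integral_add (integrableOn_mul_torus (integrableOn_periodogram N x) G₁)
      (integrableOn_mul_torus (integrableOn_periodogram N x) G₂)]
  | smul c G _ h =>
    simp only [ContinuousMap.smul_apply, smul_eq_mul, mul_left_comm _ c, integral_const_mul]
    exact h.const_mul c

/-- Trigonometric polynomials are dense in the continuous functions on the torus, and the total
masses of I_N stay bounded. The test function may move with N because it will be evaluated at the
estimates; the filter is left general so that it can be an ultrafilter. -/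
lemma tendsto_integral_periodogram_mul
    (hf : IntegrableOn f freqSquare) (hf0 : ∀ p ∈ freqSquare, 0 ≤ f p)
    (hconv : ∀ h, Tendsto (fun N : ℕ => ∫ p in freqSquare, (periodogram N x p : ℂ) * expChar h p)
      atTop (𝓝 (4 * (Real.pi : ℂ) ^ 2 * fourierCoef f h)))
    {l : Filter ℕ} (hl : l ≤ atTop) {G : ℕ → C(UnitAddTorus (Fin 2), ℂ)}
    {G₀ : C(UnitAddTorus (Fin 2), ℂ)} (hG : Tendsto G l (𝓝 G₀)) :
    Tendsto (fun N : ℕ => ∫ p in freqSquare, (periodogram N x p : ℂ) * G N (torusPoint p)) l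
      (𝓝 (4 * (Real.pi : ℂ) ^ 2 * ∫ p in freqSquare, (f p : ℂ) * G₀ (torusPoint p))) := by
  set I := 4 * Real.pi ^ 2 * ∫ p in freqSquare, f p with hI
  have hI0 : 0 ≤ I := by
    exact mul_nonneg (by positivity) (setIntegral_nonneg measurableSet_freqSquare hf0)
  have hIN : ∀ᶠ N in l, ∫ p in freqSquare, periodogram N x p ≤ I + 1 :=
    ((tendsto_integral_periodogram hconv).mono_left hl).eventually (ge_mem_nhds (by linarith))
  rw [Metric.tendsto_nhds]
  intro ε hε
  -- I + 1 eventually bounds the mass of I_N, so each of the two uniform approximations costs at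
  -- most ε / 4.
  set δ := ε / (4 * (I + 1)) with hδ
  have hδ0 : 0 < δ := by positivity
  have hmem : G₀ ∈ closure (Submodule.span ℂ (Set.range (UnitAddTorus.mFourier (d := Fin 2))) :
      Set C(UnitAddTorus (Fin 2), ℂ)) := by
    rw [← Submodule.topologicalClosure_coe, UnitAddTorus.span_mFourier_closure_eq_top]
    trivial
  obtain ⟨T, hT, hGT⟩ := Metric.mem_closure_iff.1 hmem δ hδ0
  have hlim := (tendsto_integral_periodogram_mul_of_mem_span hf hconv hT).mono_left hl
  have hGT2 : ∀ᶠ N in l, dist (G N) T < δ := by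
    have : Tendsto (fun N => dist (G N) T) l (𝓝 (dist G₀ T)) := hG.dist tendsto_const_nhds
    exact this.eventually (gt_mem_nhds hGT)
  filter_upwards [hIN, hGT2, Metric.tendsto_nhds.1 hlim (ε / 4) (by positivity)] with N h1 h2 h3
  have hd : ∀ {F : ℝ × ℝ → ℝ} (hF : IntegrableOn F freqSquare) (hF0 : ∀ p ∈ freqSquare, 0 ≤ F p)
      (A B : C(UnitAddTorus (Fin 2), ℂ)),
      dist (∫ p in freqSquare, (F p : ℂ) * A (torusPoint p))
        (∫ p in freqSquare, (F p : ℂ) * B (torusPoint p)) ≤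
          (∫ p in freqSquare, F p) * dist A B := fun hF hF0 A B => by
    rw [dist_eq_norm, ← integral_sub (integrableOn_mul_torus hF A) (integrableOn_mul_torus hF B),
      dist_eq_norm]
    simp_rw [← mul_sub, ← ContinuousMap.sub_apply]
    exact norm_integral_mul_torus_le hF hF0 _
  have d1 := hd (integrableOn_periodogram N x) (fun p _ => periodogram_nonneg N x p) (G N) T
  have d2 := hd hf hf0 T G₀
  have d1' : (∫ p in freqSquare, periodogram N x p) * dist (G N) T ≤ (I + 1) * δ := by
    gcongr
  have d2' : dist (4 * (Real.pi : ℂ) ^ 2 * ∫ p in freqSquare, (f p : ℂ) * T (torusPoint p))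
      (4 * (Real.pi : ℂ) ^ 2 * ∫ p in freqSquare, (f p : ℂ) * G₀ (torusPoint p)) ≤ I * δ := by
    rw [dist_eq_norm, ← mul_sub, norm_mul, ← dist_eq_norm]
    have : ‖(4 * (Real.pi : ℂ) ^ 2)‖ = 4 * Real.pi ^ 2 := by
      simp [abs_of_pos Real.pi_pos]
    rw [this, hI, mul_assoc (4 * Real.pi ^ 2)]
    refine mul_le_mul_of_nonneg_left (d2.trans ?_) (by positivity)
    refine mul_le_mul_of_nonneg_left ?_ (setIntegral_nonneg measurableSet_freqSquare hf0)
    rw [dist_comm]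
    exact hGT.le
  have e1 : (I + 1) * δ = ε / 4 := by
    rw [hδ]
    field_simp
  have e2 : I * δ ≤ ε / 4 := by
    rw [← e1]
    gcongr
    linarith
  calc _ ≤ _ := dist_triangle4 _ (∫ p in freqSquare, (periodogram N x p : ℂ) * T (torusPoint p))
        (4 * (Real.pi : ℂ) ^ 2 * ∫ p in freqSquare, (f p : ℂ) * T (torusPoint p)) _
    _ < ε := by linarith

lemma tendsto_integral_periodogram_mul_real
    (hf : IntegrableOn f freqSquare) (hf0 : ∀ p ∈ freqSquare, 0 ≤ f p)
    (hconv : ∀ h, Tendsto (fun N : ℕ => ∫ p in freqSquare, (periodogram N x p : ℂ) * expChar h p)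
      atTop (𝓝 (4 * (Real.pi : ℂ) ^ 2 * fourierCoef f h)))
    {l : Filter ℕ} (hl : l ≤ atTop) {G : ℕ → C(UnitAddTorus (Fin 2), ℝ)}
    {G₀ : C(UnitAddTorus (Fin 2), ℝ)} (hG : Tendsto G l (𝓝 G₀)) :
    Tendsto (fun N : ℕ => ∫ p in freqSquare, periodogram N x p * G N (torusPoint p)) l
      (𝓝 (4 * Real.pi ^ 2 * ∫ p in freqSquare, f p * G₀ (torusPoint p))) := by
  set c : C(ℝ, ℂ) := ⟨fun t => (t : ℂ), Complex.continuous_ofReal⟩ with hc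
  have hG' : Tendsto (fun N => c.comp (G N)) l (𝓝 (c.comp G₀)) :=
    ((ContinuousMap.continuous_postcomp c).tendsto G₀).comp hG
  have h := tendsto_integral_periodogram_mul hf hf0 hconv hl hG'
  have e : ∀ (F : ℝ × ℝ → ℝ) (A : C(UnitAddTorus (Fin 2), ℝ)),
      ∫ p in freqSquare, (F p : ℂ) * (c.comp A) (torusPoint p) =
        ((∫ p in freqSquare, F p * A (torusPoint p) : ℝ) : ℂ) := fun F A => by
    rw [← integral_complex_ofReal]
    simp [hc]
  simp_rw [e] at h
  have := (Complex.continuous_re.tendsto _).comp h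
  simpa [Function.comp_def, ← Complex.ofReal_pow] using this

end WeakConvergence

end Periodogram

/-! ### The factors |1 - α e^{-ix}| -/

section Gain

/-- The modulus `|1 - α e^{-ix}|`. -/
def gain (α x : ℝ) : ℝ := ‖1 - (α : ℂ) * Complex.exp (-(Complex.I * (x : ℂ)))‖

@[fun_prop]
lemma continuous_gain_uncurry : Continuous fun q : ℝ × ℝ => gain q.1 q.2 := by
  unfold gain
  fun_prop

@[fun_prop]
lemma continuous_gain (α : ℝ) : Continuous (gain α) := by
  unfold gain
  fun_prop

lemma gain_nonneg (α x : ℝ) : 0 ≤ gain α x := norm_nonneg _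

lemma norm_exp_neg_I_mul (x : ℝ) : ‖Complex.exp (-(Complex.I * (x : ℂ)))‖ = 1 := by
  rw [show -(Complex.I * (x : ℂ)) = ((-x : ℝ) : ℂ) * Complex.I by push_cast; ring]
  exact Complex.norm_exp_ofReal_mul_I _

lemma gain_pos {α : ℝ} (hα : |α| < 1) (x : ℝ) : 0 < gain α x := by
  refine norm_pos_iff.2 fun h => ?_
  have h1 : ‖(1 : ℂ)‖ = ‖(α : ℂ) * Complex.exp (-(Complex.I * (x : ℂ)))‖ := by
    rw [sub_eq_zero.1 h]
  rw [norm_mul, norm_exp_neg_I_mul, norm_one, Complex.norm_real, mul_one, Real.norm_eq_abs] at h1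
  linarith

lemma gain_le_two {α : ℝ} (hα : |α| ≤ 1) (x : ℝ) : gain α x ≤ 2 := by
  refine (norm_sub_le _ _).trans ?_
  rw [norm_mul, norm_exp_neg_I_mul, norm_one, Complex.norm_real, mul_one, Real.norm_eq_abs]
  linarith

lemma gain_eq_norm_circleMap_sub (α x : ℝ) : gain α x = ‖circleMap 0 1 x - α‖ := by
  have h : circleMap 0 1 x - (α : ℂ) =
      Complex.exp (Complex.I * x) * (1 - (α : ℂ) * Complex.exp (-(Complex.I * (x : ℂ)))) := by
    rw [mul_sub, mul_left_comm, ← Complex.exp_add, add_neg_cancel, Complex.exp_zero, circleMap,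
      mul_comm Complex.I]
    simp
  rw [h, norm_mul, mul_comm Complex.I (x : ℂ), Complex.norm_exp_ofReal_mul_I, one_mul, gain,
    mul_comm Complex.I]

lemma gain_sq (α x : ℝ) : gain α x ^ 2 = 1 + α ^ 2 - 2 * α * Real.cos x := by
  rw [gain_eq_norm_circleMap_sub, ← Complex.normSq_eq_norm_sq, Complex.normSq_apply]
  simp only [circleMap, zero_add, Complex.ofReal_one, one_mul, Complex.sub_re, Complex.sub_im,
    Complex.ofReal_re, Complex.ofReal_im, Complex.exp_ofReal_mul_I_re, Complex.exp_ofReal_mul_I_im]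
  nlinarith [Real.sin_sq_add_cos_sq x]

lemma gain_neg (α x : ℝ) : gain α (-x) = gain α x := by
  have := gain_sq α (-x)
  rw [Real.cos_neg, ← gain_sq] at this
  exact (pow_left_inj₀ (gain_nonneg _ _) (gain_nonneg _ _) two_ne_zero).1 this

/-- Here |1 - e^{-ix}| = 2 |sin(x/2)|, and Jordan's inequality applies. This reduces integrability
of negative powers to that of powers of |x|. -/
lemma mul_abs_le_gain_one {x : ℝ} (hx : |x| ≤ Real.pi) : 2 / Real.pi * |x| ≤ gain 1 x := by
  have h : gain 1 x = 2 * |Real.sin (x / 2)| := by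
    rw [gain_eq_norm_circleMap_sub]
    have := Complex.norm_exp_I_mul_ofReal_sub_one x
    rw [mul_comm Complex.I] at this
    simpa [circleMap] using this
  have h2 := Real.mul_abs_le_abs_sin (x := x / 2) (by rw [abs_div, abs_two]; linarith)
  rw [abs_div, abs_two] at h2
  rw [h]
  linarith

lemma gain_one_pos {x : ℝ} (hx : |x| ≤ Real.pi) (hx0 : x ≠ 0) : 0 < gain 1 x :=
  lt_of_lt_of_le (by positivity) (mul_abs_le_gain_one hx)

lemma integrableOn_gain_one_rpow {r : ℝ} (hr : -1 < r) :
    IntegrableOn (fun x => gain 1 x ^ r) (Set.Icc (-Real.pi) Real.pi) := by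
  rcases le_or_gt 0 r with h0 | h0
  · exact ((continuous_gain 1).rpow_const fun _ => Or.inr h0).continuousOn.integrableOn_compact
      isCompact_Icc
  have hm : Measurable fun x => gain 1 x ^ r := (continuous_gain 1).measurable.pow_const r
  have hright : IntervalIntegrable (fun x => gain 1 x ^ r) volume 0 Real.pi := by
    have hb : IntervalIntegrable (fun x : ℝ => (2 / Real.pi) ^ r * x ^ r) volume 0 Real.pi :=
      (intervalIntegral.intervalIntegrable_rpow' hr).const_mul _
    refine hb.mono_fun hm.aestronglyMeasurable ?_
    refine (ae_restrict_iff' measurableSet_uIoc).2 (ae_of_all _ fun x hx => ?_)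
    rw [Set.uIoc_of_le Real.pi_pos.le] at hx
    have hx0 : 0 < x := hx.1
    have hpi := Real.pi_pos
    have hle := mul_abs_le_gain_one (x := x) (by rw [abs_of_pos hx0]; exact hx.2)
    rw [abs_of_pos hx0] at hle
    simp only []
    rw [Real.norm_of_nonneg (Real.rpow_nonneg (gain_nonneg _ _) _),
      Real.norm_of_nonneg (by positivity), ← Real.mul_rpow (by positivity) hx0.le]
    exact Real.rpow_le_rpow_of_nonpos (by positivity) hle h0.le
  have hleft : IntervalIntegrable (fun x => gain 1 x ^ r) volume (-Real.pi) 0 := by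
    have h := (IntervalIntegrable.iff_comp_neg (f := fun x => gain 1 x ^ r) (a := 0)
      (b := Real.pi)).1 hright
    simp only [gain_neg, neg_zero] at h
    exact h.symm
  rw [integrableOn_Icc_iff_integrableOn_Ioc,
    ← intervalIntegrable_iff_integrableOn_Ioc_of_le (by linarith [Real.pi_pos])]
  exact hleft.trans hright

lemma volume_restrict_freqSquare : (volume : Measure (ℝ × ℝ)).restrict freqSquare =
    ((volume : Measure ℝ).restrict (Set.Icc (-Real.pi) Real.pi)).prod
      ((volume : Measure ℝ).restrict (Set.Icc (-Real.pi) Real.pi)) := by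
  rw [Measure.prod_restrict, freqSquare, Measure.volume_eq_prod]

lemma integrableOn_gain_rpow_mul_gain_rpow {r₁ r₂ : ℝ} (h₁ : -1 < r₁) (h₂ : -1 < r₂) :
    IntegrableOn (fun p : ℝ × ℝ => gain 1 p.1 ^ r₁ * gain 1 p.2 ^ r₂) freqSquare := by
  rw [IntegrableOn, volume_restrict_freqSquare]
  exact (integrableOn_gain_one_rpow h₁).mul_prod (integrableOn_gain_one_rpow h₂)

lemma _root_.MeasureTheory.IntegrableOn.mul_continuous_freqSquare {g h : ℝ × ℝ → ℝ}
    (hg : IntegrableOn g freqSquare) (hh : Continuous h) :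
    IntegrableOn (fun p => g p * h p) freqSquare :=
  hg.mul_continuousOn hh.continuousOn isCompact_freqSquare

lemma ae_gain_one_pos : ∀ᵐ p ∂(volume : Measure (ℝ × ℝ)).restrict freqSquare,
    0 < gain 1 p.1 ∧ 0 < gain 1 p.2 := by
  have h1 : ∀ᵐ x ∂(volume : Measure ℝ).restrict (Set.Icc (-Real.pi) Real.pi), 0 < gain 1 x := by
    refine (ae_restrict_iff' measurableSet_Icc).2 ?_
    filter_upwards [(measure_singleton (μ := (volume : Measure ℝ)) 0 : _ = _) |>
      compl_mem_ae_iff.2] with x hx hx'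
    exact gain_one_pos (abs_le.2 hx') hx
  rw [volume_restrict_freqSquare]
  filter_upwards [Measure.quasiMeasurePreserving_fst.ae h1, Measure.quasiMeasurePreserving_snd.ae h1]
    with p hp1 hp2 using ⟨hp1, hp2⟩

end Gain

/-! ### Integrability of the density and existence of minimizers -/

section SpectralDensity

lemma specDensity_eq (σ : ℝ) (θ : Param) (p : ℝ × ℝ) :
    specDensity σ θ p = σ ^ 2 / (4 * Real.pi ^ 2) *
      (gain 1 p.1 ^ (-2 * θ.2.2.1) * gain 1 p.2 ^ (-2 * θ.2.2.2) /
        (gain θ.1 p.1 * gain θ.2.1 p.2) ^ 2) := by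
  simp only [specDensity, arPoly, gain, norm_mul, Complex.ofReal_one, one_mul]

lemma inv_specDensity_eq (σ : ℝ) (θ : Param) (p : ℝ × ℝ) :
    (specDensity σ θ p)⁻¹ = 4 * Real.pi ^ 2 / σ ^ 2 *
      (gain 1 p.1 ^ (2 * θ.2.2.1) * gain 1 p.2 ^ (2 * θ.2.2.2) *
        (gain θ.1 p.1 * gain θ.2.1 p.2) ^ 2) := by
  rw [specDensity_eq, neg_mul, neg_mul, Real.rpow_neg (gain_nonneg _ _),
    Real.rpow_neg (gain_nonneg _ _)]
  simp only [mul_inv, inv_inv, div_eq_mul_inv]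
  ring

lemma specDensity_nonneg (σ : ℝ) (θ : Param) (p : ℝ × ℝ) : 0 ≤ specDensity σ θ p := by
  have := gain_nonneg 1
  rw [specDensity_eq]
  have h1 := Real.rpow_nonneg (this p.1) (-2 * θ.2.2.1)
  have h2 := Real.rpow_nonneg (this p.2) (-2 * θ.2.2.2)
  positivity

lemma continuous_specDensity_amplitude {σ : ℝ} {θ : Param} (hθ : θ ∈ paramSpace) :
    Continuous fun p : ℝ × ℝ => σ ^ 2 / (4 * Real.pi ^ 2) / (gain θ.1 p.1 * gain θ.2.1 p.2) ^ 2 := by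
  refine continuous_const.div (by fun_prop) fun p => ?_
  have h1 := gain_pos hθ.1 p.1
  have h2 := gain_pos hθ.2.1 p.2
  positivity

/-- The condition -2d > -1 is strict, so it survives multiplication of the exponent by 1 + ε for
small ε. -/
lemma exists_integrableOn_specDensity_rpow {σ : ℝ} (hσ : 0 < σ) {θ : Param} (hθ : θ ∈ paramSpace) :
    ∃ ε : ℝ, 0 < ε ∧ ε ≤ 1 / 2 ∧
      IntegrableOn (fun p => specDensity σ θ p ^ (1 + ε)) freqSquare := by
  obtain ⟨hα, hβ, h1, h2⟩ := id hθ
  have key : ∀ d : ℝ, |d| < 1 / 2 → ∀ᶠ ε : ℝ in 𝓝[>] 0, -1 < -2 * d * (1 + ε) := fun d hd => by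
    have hlim : Tendsto (fun ε : ℝ => -2 * d * (1 + ε)) (𝓝[>] 0) (𝓝 (-2 * d * (1 + 0))) := by
      refine Tendsto.mono_left ?_ nhdsWithin_le_nhds
      exact Continuous.tendsto (by fun_prop) 0
    refine hlim.eventually (lt_mem_nhds ?_)
    linarith [(abs_lt.1 hd).2]
  have hpos : ∀ᶠ ε : ℝ in 𝓝[>] 0, 0 < ε := self_mem_nhdsWithin
  have hlt : ∀ᶠ ε : ℝ in 𝓝[>] 0, ε < 1 / 2 :=
    nhdsWithin_le_nhds (gt_mem_nhds (by norm_num))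
  obtain ⟨ε, h1', h2', hε0, hε⟩ :=
    ((key _ h1).and ((key _ h2).and (hpos.and hlt))).exists
  refine ⟨ε, hε0, hε.le, ?_⟩
  have hi := (integrableOn_gain_rpow_mul_gain_rpow h1' h2').mul_continuous_freqSquare
    ((continuous_specDensity_amplitude (σ := σ) hθ).rpow_const (p := 1 + ε) fun p => Or.inl (by
      have h1 := gain_pos hθ.1 p.1
      have h2 := gain_pos hθ.2.1 p.2
      have := Real.pi_pos
      positivity))
  refine hi.congr_fun (fun p _ => ?_) measurableSet_freqSquare
  have g1 := gain_nonneg 1 p.1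
  have g2 := gain_nonneg 1 p.2
  have e : specDensity σ θ p = gain 1 p.1 ^ (-2 * θ.2.2.1) * gain 1 p.2 ^ (-2 * θ.2.2.2) *
      (σ ^ 2 / (4 * Real.pi ^ 2) / (gain θ.1 p.1 * gain θ.2.1 p.2) ^ 2) := by
    rw [specDensity_eq]
    ring
  simp only []
  rw [e, Real.mul_rpow (by positivity) (by positivity), Real.mul_rpow (by positivity) (by positivity),
    ← Real.rpow_mul g1, ← Real.rpow_mul g2]

lemma integrableOn_mul_inv_specDensity {σ : ℝ} {θ : Param} (hθ : θ ∈ paramSpace) {g : ℝ × ℝ → ℝ}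
    (hg : Continuous g) : IntegrableOn (fun p => g p / specDensity σ θ p) freqSquare := by
  have h1 := (abs_lt.1 hθ.2.2.1).1
  have h2 := (abs_lt.1 hθ.2.2.2).1
  have hi := (integrableOn_gain_rpow_mul_gain_rpow (r₁ := 2 * θ.2.2.1) (r₂ := 2 * θ.2.2.2)
    (by linarith) (by linarith)).mul_continuous_freqSquare
    (h := fun p => 4 * Real.pi ^ 2 / σ ^ 2 * (gain θ.1 p.1 * gain θ.2.1 p.2) ^ 2 * g p)
    (by fun_prop)
  refine hi.congr_fun (fun p _ => ?_) measurableSet_freqSquare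
  simp only [div_eq_mul_inv _ (specDensity σ θ p), inv_specDensity_eq]
  ring

lemma exists_abs_le_of_isCompact {K : Set Param} (hK : IsCompact K) (hKsub : K ⊆ paramSpace) :
    ∃ s : ℝ, s < 1 / 2 ∧ ∀ θ ∈ K, |θ.2.2.1| ≤ s ∧ |θ.2.2.2| ≤ s := by
  rcases K.eq_empty_or_nonempty with rfl | hne
  · exact ⟨0, by norm_num, by simp⟩
  obtain ⟨θ, hθ, hmax⟩ := hK.exists_isMaxOn hne
    (f := fun θ : Param => max |θ.2.2.1| |θ.2.2.2|) (by fun_prop)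
  have h := hKsub hθ
  exact ⟨_, max_lt h.2.2.1 h.2.2.2, fun θ' hθ' => max_le_iff.1 (hmax hθ')⟩

/-- A bound uniform in d for the dominated convergence below: the excess exponent 2d + 2s lies in
[0, 2] and g ≤ 2. -/
lemma rpow_le_four_mul_rpow {g d s : ℝ} (hg : 0 < g) (hg2 : g ≤ 2) (hd : |d| ≤ s) (hs : s < 1 / 2) :
    g ^ (2 * d) ≤ 4 * g ^ (-2 * s) := by
  have hd' := abs_le.1 hd
  have e : g ^ (2 * d) = g ^ (2 * d + 2 * s) * g ^ (-2 * s) := by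
    rw [← Real.rpow_add hg]
    congr 1
    ring
  rw [e]
  refine mul_le_mul_of_nonneg_right ?_ (by positivity)
  calc g ^ (2 * d + 2 * s) ≤ 2 ^ (2 * d + 2 * s) := Real.rpow_le_rpow hg.le hg2 (by linarith)
    _ ≤ 2 ^ (2 : ℝ) := Real.rpow_le_rpow_of_exponent_le (by norm_num) (by linarith)
    _ = 4 := by norm_num

lemma continuousOn_whittleObjective {σ : ℝ} {K : Set Param} (hK : IsCompact K)
    (hKsub : K ⊆ paramSpace) (N : ℕ) (x : ℤ × ℤ → ℝ) :
    ContinuousOn (whittleObjective σ N x) K := by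
  obtain ⟨s, hs, hKs⟩ := exists_abs_le_of_isCompact hK hKsub
  have hc := continuous_periodogram N x
  refine continuousOn_of_dominated
    -- By compactness s < 1/2 works on all of K, so -2s > -1. The constant 256 is 4 · 4 from the two
    -- memory factors times (2 · 2)² from the autoregressive ones.
    (bound := fun p => gain 1 p.1 ^ (-2 * s) * gain 1 p.2 ^ (-2 * s) *
      (periodogram N x p * (4 * Real.pi ^ 2 / σ ^ 2 * 256)))
    (fun θ hθ => (integrableOn_mul_inv_specDensity (hKsub hθ) hc).1) (fun θ hθ => ?_) ?_ ?_
  · filter_upwards [ae_gain_one_pos] with p hp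
    have h0 : 0 ≤ periodogram N x p := periodogram_nonneg N x p
    rw [Real.norm_of_nonneg (div_nonneg h0 (specDensity_nonneg _ _ _)), div_eq_mul_inv,
      inv_specDensity_eq]
    have a1 := gain_nonneg θ.1 p.1
    have a2 := gain_nonneg θ.2.1 p.2
    have b1 := gain_le_two (hKsub hθ).1.le p.1
    have b2 := gain_le_two (hKsub hθ).2.1.le p.2
    have c1 := rpow_le_four_mul_rpow hp.1 (gain_le_two (by simp) p.1) (hKs θ hθ).1 hs
    have c2 := rpow_le_four_mul_rpow hp.2 (gain_le_two (by simp) p.2) (hKs θ hθ).2 hs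
    have g1 := hp.1
    have g2 := hp.2
    calc periodogram N x p * (4 * Real.pi ^ 2 / σ ^ 2 * (gain 1 p.1 ^ (2 * θ.2.2.1) *
          gain 1 p.2 ^ (2 * θ.2.2.2) * (gain θ.1 p.1 * gain θ.2.1 p.2) ^ 2))
        ≤ periodogram N x p * (4 * Real.pi ^ 2 / σ ^ 2 * ((4 * gain 1 p.1 ^ (-2 * s)) *
          (4 * gain 1 p.2 ^ (-2 * s)) * (2 * 2) ^ 2)) := by gcongr
      _ = _ := by ring
  · exact (integrableOn_gain_rpow_mul_gain_rpow (by linarith) (by linarith)).mul_continuous_freqSquare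
      (by fun_prop)
  -- Points on the axes are discarded, since the power 0 ^ r is not continuous in r at r = 0.
  · filter_upwards [ae_gain_one_pos] with p hp
    simp only [div_eq_mul_inv (periodogram N x p), inv_specDensity_eq]
    have c1 : Continuous fun θ : Param => gain 1 p.1 ^ (2 * θ.2.2.1) :=
      continuous_const.rpow (by fun_prop) fun _ => Or.inl hp.1.ne'
    have c2 : Continuous fun θ : Param => gain 1 p.2 ^ (2 * θ.2.2.2) :=
      continuous_const.rpow (by fun_prop) fun _ => Or.inl hp.2.ne'
    have c3 : Continuous fun θ : Param => gain θ.1 p.1 :=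
      continuous_gain_uncurry.comp (by fun_prop : Continuous fun θ : Param => (θ.1, p.1))
    have c4 : Continuous fun θ : Param => gain θ.2.1 p.2 :=
      continuous_gain_uncurry.comp (by fun_prop : Continuous fun θ : Param => (θ.2.1, p.2))
    exact Continuous.continuousOn (by fun_prop)

lemma exists_isWhittleEstimate {σ : ℝ} {K : Set Param} (hK : IsCompact K) (hne : K.Nonempty)
    (hKsub : K ⊆ paramSpace) (N : ℕ) (x : ℤ × ℤ → ℝ) : ∃ θ, IsWhittleEstimate σ K N x θ := by
  obtain ⟨θ, hθ, hmin⟩ := hK.exists_isMinOn hne (continuousOn_whittleObjective hK hKsub N x)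
  exact ⟨θ, hθ, fun θ' hθ' => hmin hθ'⟩

end SpectralDensity

/-! ### Jensen's formula and identifiability of the parameter -/

section Identification

lemma intervalIntegrable_log_gain (α a b : ℝ) :
    IntervalIntegrable (fun x => Real.log (gain α x)) volume a b := by
  simp_rw [gain_eq_norm_circleMap_sub]
  have hp : Function.Periodic (fun x => Real.log ‖circleMap 0 1 x - α‖) (2 * Real.pi) := fun x => by
    simp only [periodic_circleMap 0 1 x]
  exact hp.intervalIntegrable₀ (by positivity)
    (circleIntegrable_log_norm_sub_const (a := (α : ℂ)) (c := 0) 1) a b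

lemma integrableOn_log_gain (α : ℝ) :
    IntegrableOn (fun x => Real.log (gain α x)) (Set.Icc (-Real.pi) Real.pi) := by
  rw [integrableOn_Icc_iff_integrableOn_Ioc,
    ← intervalIntegrable_iff_integrableOn_Ioc_of_le (by linarith [Real.pi_pos])]
  exact intervalIntegrable_log_gain _ _ _

/-- Jensen's formula: the mean of log |z - α| over the unit circle is log⁺ |α|, which vanishes for
|α| ≤ 1. The value α = 1 covers the memory factors. -/
lemma integral_log_gain {α : ℝ} (hα : |α| ≤ 1) :
    ∫ x in Set.Icc (-Real.pi) Real.pi, Real.log (gain α x) = 0 := by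
  have h := circleAverage_log_norm_sub_const_eq_posLog (a := (α : ℂ))
  have hp : Function.Periodic (fun x => Real.log ‖circleMap 0 1 x - α‖) (2 * Real.pi) := fun x => by
    simp only [periodic_circleMap 0 1 x]
  have h0 : Real.posLog ‖(α : ℂ)‖ = 0 := by
    rw [Real.posLog_eq_zero_iff]
    simpa using hα
  rw [h0, Real.circleAverage_def, smul_eq_mul, mul_eq_zero] at h
  have h1 := h.resolve_left (by positivity)
  have h2 := hp.intervalIntegral_add_eq 0 (-Real.pi)
  rw [zero_add, h1, show -Real.pi + 2 * Real.pi = Real.pi by ring] at h2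
  rw [integral_Icc_eq_integral_Ioc,
    ← intervalIntegral.integral_of_le (by linarith [Real.pi_pos])]
  simp_rw [gain_eq_norm_circleMap_sub]
  exact h2.symm

lemma integrableOn_log_gain_fst (α : ℝ) :
    IntegrableOn (fun p : ℝ × ℝ => Real.log (gain α p.1)) freqSquare := by
  rw [IntegrableOn, volume_restrict_freqSquare]
  exact (integrableOn_log_gain α).comp_fst _

lemma integrableOn_log_gain_snd (α : ℝ) :
    IntegrableOn (fun p : ℝ × ℝ => Real.log (gain α p.2)) freqSquare := by
  rw [IntegrableOn, volume_restrict_freqSquare]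
  exact (integrableOn_log_gain α).comp_snd _

lemma integral_log_gain_fst {α : ℝ} (hα : |α| ≤ 1) :
    ∫ p in freqSquare, Real.log (gain α p.1) = 0 := by
  rw [volume_restrict_freqSquare, integral_fun_fst fun x => Real.log (gain α x),
    integral_log_gain hα, smul_zero]

lemma integral_log_gain_snd {α : ℝ} (hα : |α| ≤ 1) :
    ∫ p in freqSquare, Real.log (gain α p.2) = 0 := by
  rw [volume_restrict_freqSquare, integral_fun_snd fun x => Real.log (gain α x),
    integral_log_gain hα, smul_zero]

lemma log_specDensity {σ : ℝ} (hσ : 0 < σ) {θ : Param} (hθ : θ ∈ paramSpace) {p : ℝ × ℝ}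
    (h1 : 0 < gain 1 p.1) (h2 : 0 < gain 1 p.2) :
    Real.log (specDensity σ θ p) = Real.log (σ ^ 2 / (4 * Real.pi ^ 2)) +
      (-2 * θ.2.2.1) * Real.log (gain 1 p.1) + (-2 * θ.2.2.2) * Real.log (gain 1 p.2) +
      (-2) * Real.log (gain θ.1 p.1) + (-2) * Real.log (gain θ.2.1 p.2) := by
  have a1 := gain_pos hθ.1 p.1
  have a2 := gain_pos hθ.2.1 p.2
  have := Real.pi_pos
  have g1 := Real.rpow_pos_of_pos h1 (-2 * θ.2.2.1)
  have g2 := Real.rpow_pos_of_pos h2 (-2 * θ.2.2.2)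
  rw [specDensity_eq, Real.log_mul (by positivity) (by positivity),
    Real.log_div (mul_pos g1 g2).ne' (by positivity), Real.log_mul g1.ne' g2.ne', Real.log_rpow h1, Real.log_rpow h2, Real.log_pow, Real.log_mul a1.ne' a2.ne']
  push_cast
  ring

lemma specDensity_pos {σ : ℝ} (hσ : 0 < σ) {θ : Param} (hθ : θ ∈ paramSpace) {p : ℝ × ℝ}
    (h1 : 0 < gain 1 p.1) (h2 : 0 < gain 1 p.2) : 0 < specDensity σ θ p := by
  have a1 := gain_pos hθ.1 p.1
  have a2 := gain_pos hθ.2.1 p.2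
  have := Real.pi_pos
  rw [specDensity_eq]
  positivity

lemma volume_freqSquare : volume.real freqSquare = 4 * Real.pi ^ 2 := by
  rw [freqSquare, Measure.volume_eq_prod, measureReal_prod_prod, Real.volume_real_Icc_of_le
    (by linarith [Real.pi_pos])]
  ring

/-- All factors depending on θ have logarithms of integral zero. In prediction terms, every model
has the same innovation variance. -/
lemma integral_log_specDensity {σ : ℝ} (hσ : 0 < σ) {θ : Param} (hθ : θ ∈ paramSpace) :
    IntegrableOn (fun p => Real.log (specDensity σ θ p)) freqSquare ∧
    ∫ p in freqSquare, Real.log (specDensity σ θ p) =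
      4 * Real.pi ^ 2 * Real.log (σ ^ 2 / (4 * Real.pi ^ 2)) := by
  have hae : (fun p => Real.log (specDensity σ θ p)) =ᵐ[volume.restrict freqSquare]
      fun p => Real.log (σ ^ 2 / (4 * Real.pi ^ 2)) +
        (-2 * θ.2.2.1) * Real.log (gain 1 p.1) + (-2 * θ.2.2.2) * Real.log (gain 1 p.2) +
        (-2) * Real.log (gain θ.1 p.1) + (-2) * Real.log (gain θ.2.1 p.2) := by
    filter_upwards [ae_gain_one_pos] with p hp
    exact log_specDensity hσ hθ hp.1 hp.2
  have i0 : Integrable (fun _ : ℝ × ℝ => Real.log (σ ^ 2 / (4 * Real.pi ^ 2)))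
      (volume.restrict freqSquare) := continuous_const.integrableOn_freqSquare
  have i1 : Integrable (fun p : ℝ × ℝ => (-2 * θ.2.2.1) * Real.log (gain 1 p.1))
      (volume.restrict freqSquare) := (integrableOn_log_gain_fst 1).const_mul _
  have i2 : Integrable (fun p : ℝ × ℝ => (-2 * θ.2.2.2) * Real.log (gain 1 p.2))
      (volume.restrict freqSquare) := (integrableOn_log_gain_snd 1).const_mul _
  have i3 : Integrable (fun p : ℝ × ℝ => (-2) * Real.log (gain θ.1 p.1))
      (volume.restrict freqSquare) := (integrableOn_log_gain_fst _).const_mul _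
  have i4 : Integrable (fun p : ℝ × ℝ => (-2) * Real.log (gain θ.2.1 p.2))
      (volume.restrict freqSquare) := (integrableOn_log_gain_snd _).const_mul _
  refine ⟨Integrable.congr ((((i0.add i1).add i2).add i3).add i4) hae.symm, ?_⟩
  rw [integral_congr_ae hae, integral_add (((i0.fun_add i1).fun_add i2).fun_add i3) i4,
    integral_add ((i0.fun_add i1).fun_add i2) i3, integral_add (i0.fun_add i1) i2,
    integral_add i0 i1]
  simp_rw [integral_const_mul]
  rw [integral_log_gain_fst (by simp), integral_log_gain_snd (by simp),
    integral_log_gain_fst hθ.1.le, integral_log_gain_snd hθ.2.1.le, setIntegral_const,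
    volume_freqSquare, smul_eq_mul]
  ring

/-- A Kullback–Leibler argument: with t the ratio of the densities, t - 1 - log t ≥ 0 with equality
only at t = 1, while its integral is at most 0 because the two log-integrals cancel. -/
lemma specDensity_ae_eq_of_integral_div_le {σ : ℝ} (hσ : 0 < σ) {θ₀ θ : Param}
    (hθ₀ : θ₀ ∈ paramSpace) (hθ : θ ∈ paramSpace)
    (hi : IntegrableOn (fun p => specDensity σ θ₀ p / specDensity σ θ p) freqSquare)
    (hle : ∫ p in freqSquare, specDensity σ θ₀ p / specDensity σ θ p ≤ 4 * Real.pi ^ 2) :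
    specDensity σ θ₀ =ᵐ[volume.restrict freqSquare] specDensity σ θ := by
  obtain ⟨l₀, e₀⟩ := integral_log_specDensity hσ hθ₀
  obtain ⟨l, e⟩ := integral_log_specDensity hσ hθ
  set g : ℝ × ℝ → ℝ := fun p => specDensity σ θ₀ p / specDensity σ θ p - 1 -
    (Real.log (specDensity σ θ₀ p) - Real.log (specDensity σ θ p)) with hg
  have i1 : IntegrableOn (fun _ : ℝ × ℝ => (1 : ℝ)) freqSquare :=
    continuous_const.integrableOn_freqSquare
  have i2 : Integrable (fun p => specDensity σ θ₀ p / specDensity σ θ p - 1)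
      (volume.restrict freqSquare) := Integrable.sub hi i1
  have i3 : Integrable (fun p => Real.log (specDensity σ θ₀ p) - Real.log (specDensity σ θ p))
      (volume.restrict freqSquare) := Integrable.sub l₀ l
  have hgi : Integrable g (volume.restrict freqSquare) := i2.sub i3
  have hgle : ∫ p in freqSquare, g p ≤ 0 := by
    rw [hg, integral_sub i2 i3, integral_sub hi i1, integral_sub l₀ l, e₀, e, setIntegral_const,
      volume_freqSquare, smul_eq_mul]
    linarith
  have hglog : ∀ᵐ p ∂volume.restrict freqSquare,
      0 ≤ g p ∧ (g p = 0 → specDensity σ θ₀ p = specDensity σ θ p) := by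
    filter_upwards [ae_gain_one_pos] with p hp
    have h₀ := specDensity_pos hσ hθ₀ hp.1 hp.2
    have h := specDensity_pos hσ hθ hp.1 hp.2
    simp only [hg]
    rw [← Real.log_div h₀.ne' h.ne']
    refine ⟨by linarith [Real.log_le_sub_one_of_pos (div_pos h₀ h)], fun h0 => ?_⟩
    by_contra hne
    have := Real.log_lt_sub_one_of_pos (div_pos h₀ h) fun h1 => hne ((div_eq_one_iff_eq h.ne').1 h1)
    linarith
  have hgnn : 0 ≤ᵐ[volume.restrict freqSquare] g := hglog.mono fun p hp => hp.1
  have hg0 := (integral_eq_zero_iff_of_nonneg_ae hgnn hgi).1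
    (le_antisymm hgle (integral_nonneg_of_ae hgnn))
  filter_upwards [hglog, hg0] with p hp hp0 using hp.2 hp0

lemma tendsto_gain (α : ℝ) : Tendsto (gain α) (𝓝[>] 0) (𝓝 (gain α 0)) :=
  ((continuous_gain α).tendsto 0).mono_left nhdsWithin_le_nhds

lemma gain_one_zero : gain 1 0 = 0 := by simp [gain]

/-- If d₀ > d, solving the identity for `gain α x ^ 2` exhibits a factor |1 - e^{-ix}|^(2(d₀-d)),
which tends to 0 as x → 0⁺, whereas |1 - α|² > 0. -/
lemma memory_le_of_marginal_eq {α₀ α d₀ d c : ℝ} (hα₀ : |α₀| < 1) (hα : |α| < 1)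
    (h : ∀ x ∈ Set.Ioo 0 Real.pi,
      gain 1 x ^ (-2 * d₀) / gain α₀ x ^ 2 = c * (gain 1 x ^ (-2 * d) / gain α x ^ 2)) : d₀ ≤ d := by
  by_contra! hlt
  have hev : ∀ᶠ x : ℝ in 𝓝[>] 0, x ∈ Set.Ioo 0 Real.pi := Ioo_mem_nhdsGT Real.pi_pos
  have hlim : Tendsto (fun x => c * gain 1 x ^ (2 * (d₀ - d)) * gain α₀ x ^ 2) (𝓝[>] 0)
      (𝓝 (c * 0 ^ (2 * (d₀ - d)) * gain α₀ 0 ^ 2)) := by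
    have h1 : Tendsto (fun x => gain 1 x ^ (2 * (d₀ - d))) (𝓝[>] 0) (𝓝 (0 ^ (2 * (d₀ - d)))) := by
      have := (tendsto_gain 1).rpow_const (p := 2 * (d₀ - d)) (Or.inr (by linarith))
      rwa [gain_one_zero] at this
    exact (h1.const_mul c).mul ((tendsto_gain α₀).pow 2)
  have hlim2 : Tendsto (fun x => c * gain 1 x ^ (2 * (d₀ - d)) * gain α₀ x ^ 2) (𝓝[>] 0)
      (𝓝 (gain α 0 ^ 2)) := by
    refine ((tendsto_gain α).pow 2).congr' ?_
    filter_upwards [hev] with x hx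
    have hpos := gain_one_pos (x := x) (by rw [abs_of_pos hx.1]; exact hx.2.le) hx.1.ne'
    have a0 := gain_pos hα₀ x
    have a1 := gain_pos hα x
    have hx' := h x hx
    have e : gain 1 x ^ (-2 * d) = gain 1 x ^ (2 * (d₀ - d)) * gain 1 x ^ (-2 * d₀) := by
      rw [← Real.rpow_add hpos]
      congr 1
      ring
    have hne : gain 1 x ^ (-2 * d₀) ≠ 0 := (Real.rpow_pos_of_pos hpos _).ne'
    rw [e] at hx'
    field_simp at hx'
    linarith
  have := tendsto_nhds_unique hlim hlim2
  rw [Real.zero_rpow (by linarith), mul_zero, zero_mul] at this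
  exact (pow_pos (gain_pos hα 0) 2).ne this

lemma marginal_injective {α₀ α d₀ d c : ℝ} (hα₀ : |α₀| < 1) (hα : |α| < 1) (hc : 0 < c)
    (h : ∀ x ∈ Set.Ioo 0 Real.pi,
      gain 1 x ^ (-2 * d₀) / gain α₀ x ^ 2 = c * (gain 1 x ^ (-2 * d) / gain α x ^ 2)) :
    α = α₀ ∧ d = d₀ := by
  have hd : d = d₀ := by
    refine le_antisymm (memory_le_of_marginal_eq (c := c⁻¹) hα hα₀ fun x hx => ?_)
      (memory_le_of_marginal_eq hα₀ hα h)
    rw [h x hx, inv_mul_cancel_left₀ hc.ne']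
  subst hd
  refine ⟨?_, rfl⟩
  have key : ∀ x ∈ Set.Ioo 0 Real.pi, gain α x ^ 2 = c * gain α₀ x ^ 2 := fun x hx => by
    have hpos := gain_one_pos (x := x) (by rw [abs_of_pos hx.1]; exact hx.2.le) hx.1.ne'
    have a0 := gain_pos hα₀ x
    have a1 := gain_pos hα x
    have hx' := h x hx
    have hne : gain 1 x ^ (-2 * d) ≠ 0 := (Real.rpow_pos_of_pos hpos _).ne'
    field_simp at hx'
    linarith
  have hpi := Real.pi_pos
  -- Two frequencies suffice: π/2 gives 1 + α² = c(1 + α₀²) and then π/3 gives α = c α₀. Eliminating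
  -- c leaves (α - α₀)(1 - α α₀) = 0.
  have k1 := key (Real.pi / 2) ⟨by linarith, by linarith⟩
  have k2 := key (Real.pi / 3) ⟨by linarith, by linarith⟩
  rw [gain_sq, gain_sq, Real.cos_pi_div_two] at k1
  rw [gain_sq, gain_sq, Real.cos_pi_div_three] at k2
  have h1 : α = c * α₀ := by linarith
  have h2 : (α - α₀) * (1 - α * α₀) = 0 := by
    have : α * (1 + α₀ ^ 2) = α₀ * (1 + α ^ 2) := by
      have k1' : 1 + α ^ 2 = c * (1 + α₀ ^ 2) := by linarith
      rw [k1', h1]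
      ring
    linarith
  rcases mul_eq_zero.1 h2 with h3 | h3
  · linarith
  · have : |α * α₀| < 1 := by
      rw [abs_mul]
      exact mul_lt_one_of_nonneg_of_lt_one_left (abs_nonneg _) hα hα₀.le
    have := (abs_lt.1 this).2
    linarith

/-- On the open square (0, π)², away from the axes, both densities are continuous, so they agree
everywhere there. They are products of a function of x and a function of y; fixing one coordinate at
π/2 gives proportional marginals. -/
lemma eq_of_specDensity_ae_eq {σ : ℝ} (hσ : 0 < σ) {θ₀ θ : Param}
    (hθ₀ : θ₀ ∈ paramSpace) (hθ : θ ∈ paramSpace)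
    (h : specDensity σ θ₀ =ᵐ[volume.restrict freqSquare] specDensity σ θ) : θ = θ₀ := by
  set U : Set (ℝ × ℝ) := Set.Ioo 0 Real.pi ×ˢ Set.Ioo 0 Real.pi with hU
  have hsub : U ⊆ freqSquare := by
    have : Set.Ioo 0 Real.pi ⊆ Set.Icc (-Real.pi) Real.pi := fun x hx =>
      ⟨by linarith [hx.1, hx.2], hx.2.le⟩
    exact Set.prod_mono this this
  have hpos : ∀ x ∈ Set.Ioo 0 Real.pi, 0 < gain 1 x := fun x hx =>
    gain_one_pos (by rw [abs_of_pos hx.1]; exact hx.2.le) hx.1.ne'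
  have hcont : ∀ θ ∈ paramSpace, ContinuousOn (specDensity σ θ) U := fun θ hθ => by
    have e : specDensity σ θ = _ := funext fun p => specDensity_eq σ θ p
    rw [e]
    refine ContinuousOn.const_mul ?_ _
    refine ContinuousOn.div (ContinuousOn.mul ?_ ?_) (Continuous.continuousOn (by fun_prop))
      fun p _ => ?_
    · exact ContinuousOn.rpow_const (Continuous.continuousOn (by fun_prop))
        fun p hp => Or.inl (hpos _ hp.1).ne'
    · exact ContinuousOn.rpow_const (Continuous.continuousOn (by fun_prop))
        fun p hp => Or.inl (hpos _ hp.2).ne'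
    · have h1 := gain_pos hθ.1 p.1
      have h2 := gain_pos hθ.2.1 p.2
      positivity
  have hEq : Set.EqOn (specDensity σ θ₀) (specDensity σ θ) U :=
    Measure.eqOn_open_of_ae_eq (ae_restrict_of_ae_restrict_of_subset hsub h)
      (isOpen_Ioo.prod isOpen_Ioo) (hcont _ hθ₀) (hcont _ hθ)
  have hpi := Real.pi_pos
  have hmid : Real.pi / 2 ∈ Set.Ioo 0 Real.pi := ⟨by linarith, by linarith⟩
  set s := σ ^ 2 / (4 * Real.pi ^ 2) with hs
  have hspos : 0 < s := by positivity
  have hm : ∀ {α d x : ℝ}, |α| < 1 → x ∈ Set.Ioo 0 Real.pi →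
      0 < gain 1 x ^ (-2 * d) / gain α x ^ 2 := fun hα hx =>
    div_pos (Real.rpow_pos_of_pos (hpos _ hx) _) (pow_pos (gain_pos hα _) 2)
  have hfac : ∀ x ∈ Set.Ioo 0 Real.pi, ∀ y ∈ Set.Ioo 0 Real.pi,
      (gain 1 x ^ (-2 * θ₀.2.2.1) / gain θ₀.1 x ^ 2) *
        (gain 1 y ^ (-2 * θ₀.2.2.2) / gain θ₀.2.1 y ^ 2) =
      (gain 1 x ^ (-2 * θ.2.2.1) / gain θ.1 x ^ 2) *
        (gain 1 y ^ (-2 * θ.2.2.2) / gain θ.2.1 y ^ 2) := fun x hx y hy => by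
    have := hEq (show (x, y) ∈ U from ⟨hx, hy⟩)
    rw [specDensity_eq, specDensity_eq] at this
    have := mul_left_cancel₀ hspos.ne' this
    rw [div_mul_div_comm, div_mul_div_comm, ← mul_pow, ← mul_pow]
    exact this
  have h1 := marginal_injective (α₀ := θ₀.1) (α := θ.1) (d₀ := θ₀.2.2.1) (d := θ.2.2.1)
    hθ₀.1 hθ.1 (div_pos (hm (d := θ.2.2.2) hθ.2.1 hmid) (hm (d := θ₀.2.2.2) hθ₀.2.1 hmid))
    fun x hx => by
      have hne := (hm (d := θ₀.2.2.2) hθ₀.2.1 hmid).ne'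
      rw [div_mul_eq_mul_div, eq_div_iff hne, hfac x hx _ hmid]
      ring
  have h2 := marginal_injective (α₀ := θ₀.2.1) (α := θ.2.1) (d₀ := θ₀.2.2.2) (d := θ.2.2.2)
    hθ₀.2.1 hθ.2.1 (div_pos (hm (d := θ.2.2.1) hθ.1 hmid) (hm (d := θ₀.2.2.1) hθ₀.1 hmid))
    fun x hx => by
      have hne := (hm (d := θ₀.2.2.1) hθ₀.1 hmid).ne'
      rw [div_mul_eq_mul_div, eq_div_iff hne, mul_comm, hfac _ hmid x hx]
  exact Prod.ext h1.1 (Prod.ext h2.1 (Prod.ext h1.2 h2.2))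

end Identification

/-! ### Continuous minorants of the inverse density -/

section LowerApproximation

/-- A continuous cutoff that vanishes on `[0, 1/(n+1)]` and equals `1` on `[2/(n+1), ∞)`. -/
def cutoff (n : ℕ) (u : ℝ) : ℝ := max 0 (min 1 ((n + 1) * u - 1))

/-- The power `u ^ e`, cut off continuously near `u = 0`. -/
def cutoffPow (n : ℕ) (e u : ℝ) : ℝ := cutoff n u * max u (1 / ((n : ℝ) + 1)) ^ e

@[fun_prop]
lemma continuous_cutoff (n : ℕ) : Continuous (cutoff n) := by
  unfold cutoff
  fun_prop

/-- The maximum keeps the base positive, so the power is jointly continuous in exponent and base for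
exponents of either sign. -/
lemma continuous_cutoffPow (n : ℕ) : Continuous fun q : ℝ × ℝ => cutoffPow n q.1 q.2 := by
  unfold cutoffPow
  refine Continuous.mul (by fun_prop) (Continuous.rpow (by fun_prop) (by fun_prop) fun q => Or.inl ?_)
  exact (lt_max_of_lt_right (by positivity)).ne'

lemma cutoffPow_nonneg (n : ℕ) (e u : ℝ) : 0 ≤ cutoffPow n e u :=
  mul_nonneg (le_max_left _ _)
    (Real.rpow_nonneg ((by positivity : (0 : ℝ) ≤ 1 / ((n : ℝ) + 1)).trans (le_max_right _ _)) _)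

lemma cutoffPow_le (n : ℕ) (e : ℝ) {u : ℝ} (hu : 0 ≤ u) : cutoffPow n e u ≤ u ^ e := by
  have hn : (0 : ℝ) < n + 1 := by positivity
  rcases le_total u (1 / ((n : ℝ) + 1)) with h | h
  · have h1 : (n + 1) * u - 1 ≤ 0 := by
      rw [le_div_iff₀ hn] at h
      linarith
    have h0 : cutoff n u = 0 := max_eq_left ((min_le_right _ _).trans h1)
    rw [cutoffPow, h0, zero_mul]
    positivity
  · rw [cutoffPow, max_eq_left h]
    exact mul_le_of_le_one_left (by positivity) (max_le zero_le_one (min_le_left _ _))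

lemma tendsto_cutoffPow (e : ℝ) {u : ℝ} (hu : 0 < u) :
    Tendsto (fun n => cutoffPow n e u) atTop (𝓝 (u ^ e)) := by
  refine tendsto_const_nhds.congr' ?_
  obtain ⟨k, hk⟩ := exists_nat_gt (2 / u)
  filter_upwards [eventually_ge_atTop k] with n hn
  rw [div_lt_iff₀ hu] at hk
  have hn' : (k : ℝ) ≤ n := by exact_mod_cast hn
  have h2 : 2 ≤ ((n : ℝ) + 1) * u := by nlinarith
  have h1 : cutoff n u = 1 := by
    rw [cutoff, min_eq_left (by linarith), max_eq_right zero_le_one]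
  rw [cutoffPow, h1, one_mul, max_eq_left]
  rw [div_le_iff₀ (by positivity)]
  linarith

/-- The modulus `|1 - α e^{-ix}|` as a function on the circle. -/
def circleGain (α : ℝ) (t : UnitAddCircle) : ℝ := ‖1 - (α : ℂ) * fourier (-1) t‖

@[fun_prop]
lemma continuous_circleGain : Continuous fun q : ℝ × UnitAddCircle => circleGain q.1 q.2 := by
  unfold circleGain
  fun_prop

lemma circleGain_coe (α x : ℝ) :
    circleGain α ((x / (2 * Real.pi) : ℝ) : UnitAddCircle) = gain α x := by
  rw [circleGain, fourier_coe_div_two_pi, gain]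
  simp

lemma circleGain_torusPoint_zero (α : ℝ) (p : ℝ × ℝ) :
    circleGain α (torusPoint p 0) = gain α p.1 := circleGain_coe α p.1

lemma circleGain_torusPoint_one (α : ℝ) (p : ℝ × ℝ) :
    circleGain α (torusPoint p 1) = gain α p.2 := circleGain_coe α p.2

/-- Jointly continuous lower approximations of the inverse spectral density. -/
def lowerInv (σ : ℝ) (n : ℕ) : C(Param × UnitAddTorus (Fin 2), ℝ) where
  toFun q := 4 * Real.pi ^ 2 / σ ^ 2 * (cutoffPow n (2 * q.1.2.2.1) (circleGain 1 (q.2 0)) *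
    cutoffPow n (2 * q.1.2.2.2) (circleGain 1 (q.2 1)) *
      (circleGain q.1.1 (q.2 0) * circleGain q.1.2.1 (q.2 1)) ^ 2)
  continuous_toFun := by
    have c1 : Continuous fun q : Param × UnitAddTorus (Fin 2) => circleGain 1 (q.2 0) :=
      continuous_circleGain.comp (by fun_prop : Continuous fun q : Param × UnitAddTorus (Fin 2) =>
        ((1 : ℝ), q.2 0))
    have c2 : Continuous fun q : Param × UnitAddTorus (Fin 2) => circleGain 1 (q.2 1) :=
      continuous_circleGain.comp (by fun_prop : Continuous fun q : Param × UnitAddTorus (Fin 2) =>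
        ((1 : ℝ), q.2 1))
    have c3 : Continuous fun q : Param × UnitAddTorus (Fin 2) => circleGain q.1.1 (q.2 0) :=
      continuous_circleGain.comp (by fun_prop : Continuous fun q : Param × UnitAddTorus (Fin 2) =>
        (q.1.1, q.2 0))
    have c4 : Continuous fun q : Param × UnitAddTorus (Fin 2) => circleGain q.1.2.1 (q.2 1) :=
      continuous_circleGain.comp (by fun_prop : Continuous fun q : Param × UnitAddTorus (Fin 2) =>
        (q.1.2.1, q.2 1))
    have c5 : Continuous fun q : Param × UnitAddTorus (Fin 2) =>
        cutoffPow n (2 * q.1.2.2.1) (circleGain 1 (q.2 0)) :=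
      (continuous_cutoffPow n).comp ((by fun_prop :
        Continuous fun q : Param × UnitAddTorus (Fin 2) => 2 * q.1.2.2.1).prodMk c1)
    have c6 : Continuous fun q : Param × UnitAddTorus (Fin 2) =>
        cutoffPow n (2 * q.1.2.2.2) (circleGain 1 (q.2 1)) :=
      (continuous_cutoffPow n).comp ((by fun_prop :
        Continuous fun q : Param × UnitAddTorus (Fin 2) => 2 * q.1.2.2.2).prodMk c2)
    fun_prop

lemma lowerInv_torusPoint (σ : ℝ) (n : ℕ) (θ : Param) (p : ℝ × ℝ) :
    lowerInv σ n (θ, torusPoint p) = 4 * Real.pi ^ 2 / σ ^ 2 *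
      (cutoffPow n (2 * θ.2.2.1) (gain 1 p.1) * cutoffPow n (2 * θ.2.2.2) (gain 1 p.2) *
        (gain θ.1 p.1 * gain θ.2.1 p.2) ^ 2) := by
  simp only [lowerInv, ContinuousMap.coe_mk, circleGain_torusPoint_zero, circleGain_torusPoint_one]

lemma lowerInv_nonneg (σ : ℝ) (n : ℕ) (θ : Param) (p : ℝ × ℝ) :
    0 ≤ lowerInv σ n (θ, torusPoint p) := by
  rw [lowerInv_torusPoint]
  have h1 := cutoffPow_nonneg n (2 * θ.2.2.1) (gain 1 p.1)
  have h2 := cutoffPow_nonneg n (2 * θ.2.2.2) (gain 1 p.2)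
  positivity

lemma lowerInv_le (σ : ℝ) (n : ℕ) (θ : Param) (p : ℝ × ℝ) :
    lowerInv σ n (θ, torusPoint p) ≤ (specDensity σ θ p)⁻¹ := by
  rw [lowerInv_torusPoint, inv_specDensity_eq]
  have h2 := cutoffPow_nonneg n (2 * θ.2.2.2) (gain 1 p.2)
  have g1 := Real.rpow_nonneg (gain_nonneg 1 p.1) (2 * θ.2.2.1)
  gcongr
  · exact cutoffPow_le n _ (gain_nonneg _ _)
  · exact cutoffPow_le n _ (gain_nonneg _ _)

lemma tendsto_lowerInv (σ : ℝ) (θ : Param) {p : ℝ × ℝ} (h1 : 0 < gain 1 p.1)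
    (h2 : 0 < gain 1 p.2) :
    Tendsto (fun n => lowerInv σ n (θ, torusPoint p)) atTop (𝓝 (specDensity σ θ p)⁻¹) := by
  simp_rw [lowerInv_torusPoint, inv_specDensity_eq]
  exact (((tendsto_cutoffPow _ h1).mul (tendsto_cutoffPow _ h2)).mul_const _).const_mul _

/-- The inverse spectral density is continuous on the torus if both memory parameters are
positive. -/
def invOnTorus (σ : ℝ) (θ : Param) (h₁ : 0 < θ.2.2.1) (h₂ : 0 < θ.2.2.2) :
    C(UnitAddTorus (Fin 2), ℝ) where
  toFun t := 4 * Real.pi ^ 2 / σ ^ 2 * (circleGain 1 (t 0) ^ (2 * θ.2.2.1) *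
    circleGain 1 (t 1) ^ (2 * θ.2.2.2) * (circleGain θ.1 (t 0) * circleGain θ.2.1 (t 1)) ^ 2)
  continuous_toFun := by
    have c : ∀ (α : ℝ) (i : Fin 2),
        Continuous fun t : UnitAddTorus (Fin 2) => circleGain α (t i) := fun α i =>
      continuous_circleGain.comp (by fun_prop : Continuous fun t : UnitAddTorus (Fin 2) => (α, t i))
    have c1 := (c 1 0).rpow_const (p := 2 * θ.2.2.1) fun _ => Or.inr (by linarith)
    have c2 := (c 1 1).rpow_const (p := 2 * θ.2.2.2) fun _ => Or.inr (by linarith)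
    have c3 := c θ.1 0
    have c4 := c θ.2.1 1
    fun_prop

lemma invOnTorus_torusPoint (σ : ℝ) (θ : Param) (h₁ : 0 < θ.2.2.1) (h₂ : 0 < θ.2.2.2)
    (p : ℝ × ℝ) : invOnTorus σ θ h₁ h₂ (torusPoint p) = (specDensity σ θ p)⁻¹ := by
  simp only [invOnTorus, ContinuousMap.coe_mk, circleGain_torusPoint_zero,
    circleGain_torusPoint_one, inv_specDensity_eq]

end LowerApproximation

/-! ### Cluster points of the estimates and consistency -/

section Consistency

/-- Fatou's lemma along the minorants. Integrability of the ratio is part of the conclusion: without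
it, a bound on the Bochner integral would carry no information. -/
lemma integrableOn_specDensity_div_of_forall_lowerInv_le {σ c : ℝ} {θ₀ θ : Param} (hc : 0 ≤ c)
    (hf : IntegrableOn (specDensity σ θ₀) freqSquare)
    (hle : ∀ n, ∫ p in freqSquare, specDensity σ θ₀ p * lowerInv σ n (θ, torusPoint p) ≤ c) :
    IntegrableOn (fun p => specDensity σ θ₀ p / specDensity σ θ p) freqSquare ∧
      ∫ p in freqSquare, specDensity σ θ₀ p / specDensity σ θ p ≤ c := by
  have hcont : ∀ n, Continuous fun p => lowerInv σ n (θ, torusPoint p) := fun n =>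
    (lowerInv σ n).continuous.comp (by fun_prop)
  have hint : ∀ n, IntegrableOn
      (fun p => specDensity σ θ₀ p * lowerInv σ n (θ, torusPoint p)) freqSquare := fun n =>
    hf.mul_continuous_freqSquare (hcont n)
  have hlim : ∀ᵐ p ∂volume.restrict freqSquare,
      Tendsto (fun n => specDensity σ θ₀ p * lowerInv σ n (θ, torusPoint p)) atTop
        (𝓝 (specDensity σ θ₀ p / specDensity σ θ p)) := by
    filter_upwards [ae_gain_one_pos] with p hp
    exact (tendsto_lowerInv σ θ hp.1 hp.2).const_mul _
  have hmeas : AEStronglyMeasurable (fun p => specDensity σ θ₀ p / specDensity σ θ p)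
      (volume.restrict freqSquare) :=
    aestronglyMeasurable_of_tendsto_ae atTop (fun n => (hint n).1) hlim
  have hnn : ∀ p, 0 ≤ specDensity σ θ₀ p / specDensity σ θ p := fun p =>
    div_nonneg (specDensity_nonneg _ _ _) (specDensity_nonneg _ _ _)
  have hfatou : ∫⁻ p in freqSquare, ENNReal.ofReal (specDensity σ θ₀ p / specDensity σ θ p) ≤
      ENNReal.ofReal c := by
    calc ∫⁻ p in freqSquare, ENNReal.ofReal (specDensity σ θ₀ p / specDensity σ θ p)
        = ∫⁻ p in freqSquare, liminf (fun n => ENNReal.ofReal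
            (specDensity σ θ₀ p * lowerInv σ n (θ, torusPoint p))) atTop := by
          refine lintegral_congr_ae ?_
          filter_upwards [hlim] with p hp
          exact ((ENNReal.continuous_ofReal.tendsto _).comp hp).liminf_eq.symm
      _ ≤ liminf (fun n => ∫⁻ p in freqSquare, ENNReal.ofReal
            (specDensity σ θ₀ p * lowerInv σ n (θ, torusPoint p))) atTop :=
          lintegral_liminf_le' fun n => (hint n).1.aemeasurable.ennreal_ofReal
      _ ≤ liminf (fun _ : ℕ => ENNReal.ofReal c) atTop := by
          refine liminf_le_liminf (Eventually.of_forall fun n => ?_)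
          rw [← ofReal_integral_eq_lintegral_ofReal (hint n) (ae_of_all _ fun p =>
            mul_nonneg (specDensity_nonneg _ _ _) (lowerInv_nonneg _ _ _ _))]
          exact ENNReal.ofReal_le_ofReal (hle n)
      _ = ENNReal.ofReal c := liminf_const _
  constructor
  · refine ⟨hmeas, ?_⟩
    rw [hasFiniteIntegral_iff_ofReal (ae_of_all _ hnn)]
    exact hfatou.trans_lt ENNReal.ofReal_lt_top
  · rw [integral_eq_lintegral_of_nonneg_ae (ae_of_all _ hnn) hmeas]
    exact ENNReal.toReal_le_of_le_ofReal hc hfatou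

/-- Pass to the limit in ∫ I_N · `lowerInv` at θ̂_N ≤ σ_N²(θ̂_N) ≤ σ_N²(θ₀). The left test functions
converge uniformly, by joint continuity and compactness of the torus. On the right the test function
is fixed and continuous because both true memory parameters are positive; its limit is 4π² · 4π². -/
lemma integral_lowerInv_le_of_tendsto {σ : ℝ} (hσ : 0 < σ) {K : Set Param}
    (hKsub : K ⊆ paramSpace) {θ₀ : Param} (hK₀ : θ₀ ∈ K) (h₁ : 0 < θ₀.2.2.1) (h₂ : 0 < θ₀.2.2.2)
    (hf : IntegrableOn (specDensity σ θ₀) freqSquare) {x : ℤ × ℤ → ℝ}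
    (hconv : ∀ h, Tendsto (fun N : ℕ => ∫ p in freqSquare, (periodogram N x p : ℂ) * expChar h p)
      atTop (𝓝 (4 * (Real.pi : ℂ) ^ 2 * fourierCoef (specDensity σ θ₀) h)))
    {θhat : ℕ → Param} (hθhat : ∀ N : ℕ, 1 ≤ N → IsWhittleEstimate σ K N x (θhat N))
    {l : Filter ℕ} [l.NeBot] (hl : l ≤ atTop) {θ : Param} (hθ : Tendsto θhat l (𝓝 θ)) (n : ℕ) :
    ∫ p in freqSquare, specDensity σ θ₀ p * lowerInv σ n (θ, torusPoint p) ≤ 4 * Real.pi ^ 2 := by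
  have hf0 : ∀ p ∈ freqSquare, 0 ≤ specDensity σ θ₀ p := fun p _ => specDensity_nonneg _ _ _
  have hleft := tendsto_integral_periodogram_mul_real hf hf0 hconv hl
    (((lowerInv σ n).curry.continuous.tendsto θ).comp hθ)
  have hright := tendsto_integral_periodogram_mul_real hf hf0 hconv hl
    (tendsto_const_nhds (x := invOnTorus σ θ₀ h₁ h₂))
  simp only [Function.comp_apply, ContinuousMap.curry_apply, invOnTorus_torusPoint] at hleft hright
  have hone : ∫ p in freqSquare, specDensity σ θ₀ p * (specDensity σ θ₀ p)⁻¹ = 4 * Real.pi ^ 2 := by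
    have : (fun p => specDensity σ θ₀ p * (specDensity σ θ₀ p)⁻¹) =ᵐ[volume.restrict freqSquare]
        fun _ => 1 := by
      filter_upwards [ae_gain_one_pos] with p hp
      exact mul_inv_cancel₀ (specDensity_pos hσ (hKsub hK₀) hp.1 hp.2).ne'
    rw [integral_congr_ae this, setIntegral_const, volume_freqSquare, smul_eq_mul, mul_one]
  rw [hone] at hright
  have hle := le_of_tendsto_of_tendsto hleft hright (by
    filter_upwards [hl (eventually_ge_atTop 1)] with N hN
    obtain ⟨hmem, hmin⟩ := hθhat N hN
    calc ∫ p in freqSquare, periodogram N x p * lowerInv σ n (θhat N, torusPoint p)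
        ≤ whittleObjective σ N x (θhat N) := by
          refine setIntegral_mono
            (Continuous.integrableOn_freqSquare ((continuous_periodogram N x).mul
              ((lowerInv σ n).continuous.comp (by fun_prop))))
            (integrableOn_mul_inv_specDensity (hKsub hmem) (continuous_periodogram N x))
            fun p => ?_
          simp only [div_eq_mul_inv]
          exact mul_le_mul_of_nonneg_left (lowerInv_le σ n _ p) (periodogram_nonneg N x p)
      _ ≤ whittleObjective σ N x θ₀ := hmin θ₀ hK₀
      _ = _ := by simp only [whittleObjective, div_eq_mul_inv])
  exact le_of_mul_le_mul_left hle (by positivity)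

lemma tendsto_whittleEstimate {σ : ℝ} (hσ : 0 < σ) {K : Set Param} (hK : IsCompact K)
    (hKsub : K ⊆ paramSpace) {θ₀ : Param} (hK₀ : θ₀ ∈ K) (h₁ : 0 < θ₀.2.2.1) (h₂ : 0 < θ₀.2.2.2)
    (hf : IntegrableOn (specDensity σ θ₀) freqSquare) {x : ℤ × ℤ → ℝ}
    (hconv : ∀ h, Tendsto (fun N : ℕ => ∫ p in freqSquare, (periodogram N x p : ℂ) * expChar h p)
      atTop (𝓝 (4 * (Real.pi : ℂ) ^ 2 * fourierCoef (specDensity σ θ₀) h)))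
    {θhat : ℕ → Param} (hθhat : ∀ N : ℕ, 1 ≤ N → IsWhittleEstimate σ K N x (θhat N)) :
    Tendsto θhat atTop (𝓝 θ₀) := by
  refine hK.tendsto_nhds_of_unique_mapClusterPt
    ((eventually_ge_atTop 1).mono fun N hN => (hθhat N hN).1) fun θ hθ hcl => ?_
  -- A cluster point is a limit along an ultrafilter finer than `atTop`, which takes the place of a
  -- subsequence.
  obtain ⟨U, hU, hlim⟩ := mapClusterPt_iff_ultrafilter.1 hcl
  obtain ⟨hi, hle⟩ := integrableOn_specDensity_div_of_forall_lowerInv_le (by positivity) hf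
    (integral_lowerInv_le_of_tendsto hσ hKsub hK₀ h₁ h₂ hf hconv hθhat hU hlim)
  exact eq_of_specDensity_ae_eq hσ (hKsub hK₀) (hKsub hθ)
    (specDensity_ae_eq_of_integral_div_le hσ (hKsub hK₀) (hKsub hθ) hi hle)

variable {Ω : Type*} [MeasurableSpace Ω]

/-- The only probabilistic input to consistency. There are countably many lags, so one null set
serves them all, and everything after it is deterministic for a fixed sample point. -/
lemma ae_tendsto_integral_periodogram_mul_expChar (P : Measure Ω) [IsProbabilityMeasure P]
    {X : ℤ × ℤ → Ω → ℝ} {f : ℝ × ℝ → ℝ} (hgauss : IsGaussianProcess X P)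
    (hstat : IsStationary X P) (hspec : HasSpectralDensity X P f) {ε : ℝ} (hε : 0 < ε)
    (hε1 : ε ≤ 1 / 2) (hfε : IntegrableOn (fun p => f p ^ (1 + ε)) freqSquare) :
    ∀ᵐ ω ∂P, ∀ h, Tendsto (fun N : ℕ => ∫ p in freqSquare,
      (periodogram N (fun u => X u ω) p : ℂ) * expChar h p) atTop
        (𝓝 (4 * (Real.pi : ℂ) ^ 2 * fourierCoef f h)) := by
  set m := ∫ ω, X 0 ω ∂P with hm
  set γ : ℤ × ℤ → ℝ := fun h => covariance (X (0 + h)) (X 0) P with hγ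
  have hcov : ∀ h u, ((covariance (X (u + h)) (X u) P : ℝ) : ℂ) = fourierCoef f h :=
    hspec.cov_eq_integral
  have hγf : ∀ h, ((γ h : ℝ) : ℂ) = fourierCoef f h := fun h => hcov h 0
  have hZ := IsGaussianProcess.sub_const hgauss fun _ => m
  have hmean : ∀ u, ∫ ω, X u ω ∂P = m := fun u => hstat.mean_eq u 0
  have h0 : ∀ u, ∫ ω, (X u ω - m) ∂P = 0 := fun u => by
    rw [integral_sub (hgauss.hasGaussianLaw_eval u).integrable (integrable_const _), hmean]
    simp
  have hprod : ∀ u v, ∫ ω, (X u ω - m) * (X v ω - m) ∂P = γ (u - v) := fun u v => by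
    have h1 : covariance (X (v + (u - v))) (X v) P = γ (u - v) := by
      have := (hcov (u - v) v).trans (hγf (u - v)).symm
      exact_mod_cast this
    rw [← h1, covariance, hmean, hmean, add_sub_cancel]
  obtain ⟨C, hC, hb⟩ := exists_sum_norm_sq_fourierCoef_le hspec.integrableOn hspec.nonneg hε hε1 hfε
  have hb' : ∀ N : ℕ, 1 ≤ N → ∀ h : ℤ × ℤ,
      ∑ u ∈ box N, ∑ v ∈ box N, γ (u - v + h) ^ 2 ≤ C * (N : ℝ) ^ (4 - 2 * ε) := fun N hN h => by
    refine le_trans (le_of_eq ?_) (hb N hN h)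
    refine Finset.sum_congr rfl fun u _ => Finset.sum_congr rfl fun v _ => ?_
    rw [← hγf, Complex.norm_real, Real.norm_eq_abs, sq_abs]
  filter_upwards [ae_all_iff.2 fun h =>
    ae_tendsto_lag_averages hZ h0 hprod hC (by positivity) hb' h] with ω hω h
  rw [← hγf]
  exact tendsto_integral_periodogram_mul_expChar hω h

end Consistency

end SpatialWhittle

end

theorem theorem1p1 {Ω : Type*} [MeasurableSpace Ω] (P : Measure Ω) [IsProbabilityMeasure P]
    (X : ℤ × ℤ → Ω → ℝ) (σ : ℝ) (hσ : 0 < σ)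
    (α₀ β₀ d₁₀ d₂₀ : ℝ)
    (hα : |α₀| < 1) (hβ : |β₀| < 1)
    (hd₁ : 0 < d₁₀ ∧ d₁₀ < 1 / 2) (hd₂ : 0 < d₂₀ ∧ d₂₀ < 1 / 2)
    (hgauss : IsGaussianProcess X P)
    (hstat : SpatialWhittle.IsStationary X P)
    (hspec : SpatialWhittle.HasSpectralDensity X P
      (SpatialWhittle.specDensity σ (α₀, β₀, (d₁₀, d₂₀))))
    (K : Set SpatialWhittle.Param) (hK : IsCompact K) (hKsub : K ⊆ SpatialWhittle.paramSpace)
    (hK₀ : (α₀, β₀, (d₁₀, d₂₀)) ∈ K) :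
    (∀ N : ℕ, 1 ≤ N → ∀ ω, ∃ θ,
      SpatialWhittle.IsWhittleEstimate σ K N (fun u => X u ω) θ) ∧
    ∀ θhat : ℕ → Ω → SpatialWhittle.Param,
      (∀ N : ℕ, 1 ≤ N → ∀ᵐ ω ∂P,
        SpatialWhittle.IsWhittleEstimate σ K N (fun u => X u ω) (θhat N ω)) →
      ∀ᵐ ω ∂P, Tendsto (fun N => θhat N ω) atTop (𝓝 (α₀, β₀, (d₁₀, d₂₀))) := by
  refine ⟨fun N _ ω => SpatialWhittle.exists_isWhittleEstimate hK ⟨_, hK₀⟩ hKsub N _,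
    fun θhat hθhat => ?_⟩
  obtain ⟨ε, hε, hε1, hfε⟩ := SpatialWhittle.exists_integrableOn_specDensity_rpow hσ (hKsub hK₀)
  have hest : ∀ᵐ ω ∂P, ∀ N : ℕ, 1 ≤ N →
      SpatialWhittle.IsWhittleEstimate σ K N (fun u => X u ω) (θhat N ω) :=
    ae_all_iff.2 fun N => by
      by_cases hN : 1 ≤ N
      · exact (hθhat N hN).mono fun ω hω _ => hω
      · exact ae_of_all _ fun ω h => absurd h hN
  filter_upwards [hest, SpatialWhittle.ae_tendsto_integral_periodogram_mul_expChar P hgauss hstat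
    hspec hε hε1 hfε] with ω hω hconv
  exact SpatialWhittle.tendsto_whittleEstimate hσ hK hKsub hK₀ hd₁.1 hd₂.1 hspec.integrableOn hconv hω
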